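/- Let $\Omega\subset\mathbb R^3$ be a convex polyhedral domain, i.e. the nonempty interior of the convex hull of finitely many points. Let $\mathcal T_h$ be a conforming partition of $\overline\Omega$ into finitely many tetrahedra, of mesh size $h=\max_{K\in\mathcal T_h}\operatorname{diam}K>0$. Write $(\cdot,\cdot)$ and $\|\cdot\|$ for the inner product and the norm of $L^2(\Omega)$ (for scalar, vector and matrix functions), and define * $W_h$: continuous functions on $\overline\Omega$ that are affine on each $K\in\mathcal T_h$; $F_h=\{w\in W_h: w=0\text{ on }\partial\Omega\}$; $M_h=\{q\in W_h:\int_\Omega q\,dx=0\}$; * $\mathbf V_h$: continuous vector fields on $\overline\Omega$ that vanish on $\partial\Omega$ and on each $K$ belong to $(P_1(K)\oplus\operatorname{span}\{b_K\})^3$, where $b_K$ is the product of the four barycentric coordinates of $K$ (so $\mathbf V_h\times M_h$ is the mini element); * $\mathbf{RT}_{0h}=\{\mathbf w\in \mathbf H(\mathrm{div},\Omega): \mathbf w|_K\in P_1(K)^3+x\,P_1(K)\ \forall K\in\mathcal T_h,\ \nabla\cdot\mathbf w=0\text{ in }\Omega,\ \mathbf w\cdot\mathbf n=0\text{ on }\partial\Omega\}$,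 and $\mathbf P_{0h}$ the $L^2(\Omega)^3$-orthogonal projection onto $\mathbf{RT}_{0h}$. Let $\mu,\kappa,\tau>0$, $\mathbf f^{n+1}\in L^2(\Omega)^3$ and $g^{n+1}\in L^2(\Omega)$. For given $(\sigma_h^n,\mathbf u_h^n,\theta_h^n)\in W_h\times\mathbf V_h\times F_h$, one step of the scheme is to find $(\sigma_h^{n+1},\mathbf u_h^{n+1},p_h^{n+1},\theta_h^{n+1})\in W_h\times\mathbf V_h\times M_h\times F_h$ such that, with $\rho_h^{n+1}=(\sigma_h^{n+1})^2$, $$\Big(\tfrac{\sigma_h^{n+1}-\sigma_h^n}{\tau},r_h\Big)+(\nabla\sigma_h^{n+1}\cdot\mathbf P_{0h}\mathbf u_h^n,r_h)=0\qquad\forall r_h\in W_h,$$ $$\Big(\sigma_h^{n+1}\tfrac{\sigma_h^{n+1}\mathbf u_h^{n+1}-\sigma_h^n\mathbf u_h^n}{\tau},\mathbf v_h\Big)+\mu(\nabla\mathbf u_h^{n+1},\nabla\mathbf v_h)+(\rho_h^{n+1}(\mathbf u_h^n\cdot\nabla)\mathbf u_h^{n+1},\mathbf v_h)+\tfrac12(\mathbf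 u_h^{n+1}\nabla\cdot(\rho_h^{n+1}\mathbf u_h^n),\mathbf v_h)$$ $$-(\nabla\cdot\mathbf v_h,p_h^{n+1})+(\nabla\cdot\mathbf u_h^{n+1},q_h)=(\mathbf f^{n+1},\mathbf v_h)\qquad\forall(\mathbf v_h,q_h)\in\mathbf V_h\times M_h,$$ $$\Big(\sigma_h^{n+1}\tfrac{\sigma_h^{n+1}\theta_h^{n+1}-\sigma_h^n\theta_h^n}{\tau},w_h\Big)+\kappa(\nabla\theta_h^{n+1},\nabla w_h)+(\rho_h^{n+1}(\mathbf u_h^n\cdot\nabla)\theta_h^{n+1},w_h)+\tfrac12(\theta_h^{n+1}\nabla\cdot(\rho_h^{n+1}\mathbf u_h^n),w_h)=(g^{n+1},w_h)\qquad\forall w_h\in F_h.$$ **Lemma 3.1.** There is a constant $C>0$ depending only on $\Omega$ such that for every mesh $\mathcal T_h$ as above (hence every $h>0$) and all $\mu,\kappa,\tau>0$ the following holds. (i) For all $(\sigma_h^n,\mathbf u_h^n,\theta_h^n)\in W_h\times\mathbf V_h\times F_h$ and all data $\mathbf f^{n+1}\in L^2(\Omega)^3$, $g^{n+1}\in L^2(\Omega)$,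 the step of the scheme has a unique solution $(\sigma_h^{n+1},\mathbf u_h^{n+1},p_h^{n+1},\theta_h^{n+1})\in W_h\times\mathbf V_h\times M_h\times F_h$. (ii) If, starting from any $(\sigma_h^0,\mathbf u_h^0,\theta_h^0)\in W_h\times\mathbf V_h\times F_h$, the scheme is run for $0\le n\le N-1$, then for every $0\le n\le N-1$ $$\|\sigma_h^{n+1}\|^2\le\|\sigma_h^0\|^2,$$ $$\|\sigma_h^{n+1}\theta_h^{n+1}\|^2+\kappa\tau\sum_{k=0}^{n}\|\nabla\theta_h^{k+1}\|^2\le\|\sigma_h^0\theta_h^0\|^2+\frac{C}{\kappa}\,\tau\sum_{k=0}^{n}\|g^{k+1}\|^2,$$ $$\|\sigma_h^{n+1}\mathbf u_h^{n+1}\|^2+\mu\tau\sum_{k=0}^{n}\|\nabla\mathbf u_h^{k+1}\|^2\le\|\sigma_h^0\mathbf u_h^0\|^2+\frac{C}{\mu}\,\tau\sum_{k=0}^{n}\|\mathbf f^{k+1}\|^2,$$ $$\|\sigma_h^{n+1}\mathbf u_h^{n+1}\|^2+2\mu\tau\sum_{k=0}^{n}\|\nabla\mathbf u_h^{k+1}\|^2\le2\|\sigma_h^0\mathbf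 u_h^0\|^2+\frac{2C}{\mu}\,\tau\sum_{k=0}^{n}\|\mathbf f^{k+1}\|^2.$$ -/

import Mathlib

open MeasureTheory
open scoped ContDiff RealInnerProductSpace

noncomputable section

namespace FEM

/-- Three-dimensional Euclidean space. -/
abbrev E3 : Type := EuclideanSpace ℝ (Fin 3)

/-- `Ω` is a convex polyhedral domain: the nonempty interior of the convex hull of finitely many
points of `ℝ³`. -/
def IsConvexPolyhedralDomain (Ω : Set E3) : Prop :=
  Ω.Nonempty ∧ ∃ S : Finset E3, Ω = interior (convexHull ℝ (S : Set E3))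

/-! ### Differential operators, inner products and norms

Every finite element function below is continuous on the closed domain and polynomial on each
closed tetrahedron, so its weak derivatives are the classical ones in the interiors of the
tetrahedra, hence almost everywhere. -/

/-- The gradient of a vector field, as the family of its three partial derivatives. The inner
product and the norm of this type are the Frobenius ones. -/
def vgrad (u : E3 → E3) (x : E3) : PiLp 2 (fun _ : Fin 3 => E3) :=
  WithLp.toLp 2 fun i => fderiv ℝ u x (EuclideanSpace.single i 1)

/-- The divergence of a vector field. -/
def divg (u : E3 → E3) (x : E3) : ℝ :=
  ∑ i : Fin 3, fderiv ℝ u x (EuclideanSpace.single i 1) i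

/-- The `L²(Ω)` inner product of scalar-, vector- or matrix-valued functions. -/
def ip {F : Type*} [NormedAddCommGroup F] [InnerProductSpace ℝ F] (Ω : Set E3)
    (f g : E3 → F) : ℝ :=
  ∫ x in Ω, inner ℝ (f x) (g x)

/-- The square of the `L²(Ω)` norm. -/
def normSq {F : Type*} [NormedAddCommGroup F] (Ω : Set E3) (f : E3 → F) : ℝ :=
  ∫ x in Ω, ‖f x‖ ^ 2

/-- The space `L²(Ω)` of classes of functions with values in `F`. -/
abbrev L2 (F : Type*) [NormedAddCommGroup F] (Ω : Set E3) : Type _ :=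
  Lp F 2 (volume.restrict Ω)

/-- `d ∈ L²(Ω)` is the weak divergence of `w ∈ L²(Ω)³`. -/
def IsWeakDiv (Ω : Set E3) (w : L2 E3 Ω) (d : L2 ℝ Ω) : Prop :=
  ∀ φ : E3 → ℝ, ContDiff ℝ ∞ φ → HasCompactSupport φ → tsupport φ ⊆ Ω →
    ∫ x in Ω, inner ℝ (w x) (gradient φ x) = - ∫ x in Ω, d x * φ x

/-- For `w ∈ H(div, Ω)` with weak divergence `d`: the normal trace of `w` on `∂Ω`, which is defined
by Green's formula, vanishes (`w · n = 0` on `∂Ω`). -/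
def HasZeroNormalTrace (Ω : Set E3) (w : L2 E3 Ω) (d : L2 ℝ Ω) : Prop :=
  ∀ φ : E3 → ℝ, ContDiff ℝ ∞ φ → HasCompactSupport φ →
    (∫ x in Ω, inner ℝ (w x) (gradient φ x)) + ∫ x in Ω, d x * φ x = 0

theorem integrable_inner_gradient {Ω : Set E3} (w : L2 E3 Ω) {φ : E3 → ℝ} (hφ : ContDiff ℝ ∞ φ)
    (hc : HasCompactSupport φ) :
    Integrable (fun x => inner ℝ (w x) (gradient φ x)) (volume.restrict Ω) := by
  have hcont : Continuous (gradient φ) :=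
    (InnerProductSpace.toDual ℝ E3).symm.continuous.comp (hφ.continuous_fderiv (by simp))
  have hsupp : HasCompactSupport (gradient φ) :=
    (hc.fderiv (𝕜 := ℝ)).comp_left (g := (InnerProductSpace.toDual ℝ E3).symm) (map_zero _)
  have hm : MemLp (gradient φ) 2 (volume.restrict Ω) :=
    (hcont.memLp_of_hasCompactSupport hsupp).restrict Ω
  refine (L2.integrable_inner (𝕜 := ℝ) w hm.toLp).congr ?_
  filter_upwards [hm.coeFn_toLp] with x hx
  rw [hx]

theorem integrable_mul_test {Ω : Set E3} (d : L2 ℝ Ω) {φ : E3 → ℝ} (hφ : ContDiff ℝ ∞ φ)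
    (hc : HasCompactSupport φ) : Integrable (fun x => d x * φ x) (volume.restrict Ω) :=
  MemLp.integrable_mul (p := 2) (q := 2) (Lp.memLp d) ((hφ.continuous.memLp_of_hasCompactSupport hc).restrict Ω)

theorem integral_inner_add {Ω : Set E3} (w w' : L2 E3 Ω) {φ : E3 → ℝ} (hφ : ContDiff ℝ ∞ φ)
    (hc : HasCompactSupport φ) :
    ∫ x in Ω, inner ℝ ((w + w' : L2 E3 Ω) x) (gradient φ x) =
      (∫ x in Ω, inner ℝ (w x) (gradient φ x)) + ∫ x in Ω, inner ℝ (w' x) (gradient φ x) := by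
  rw [← integral_add (integrable_inner_gradient w hφ hc) (integrable_inner_gradient w' hφ hc)]
  refine integral_congr_ae ?_
  filter_upwards [Lp.coeFn_add w w'] with x hx
  rw [hx, Pi.add_apply, inner_add_left]

theorem integral_inner_smul {Ω : Set E3} (r : ℝ) (w : L2 E3 Ω) (φ : E3 → ℝ) :
    ∫ x in Ω, inner ℝ ((r • w : L2 E3 Ω) x) (gradient φ x) =
      r * ∫ x in Ω, inner ℝ (w x) (gradient φ x) := by
  rw [← integral_const_mul]
  refine integral_congr_ae ?_
  filter_upwards [Lp.coeFn_smul r w] with x hx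
  rw [hx, Pi.smul_apply, real_inner_smul_left]

theorem integral_zero_mul {Ω : Set E3} (φ : E3 → ℝ) :
    ∫ x in Ω, (0 : L2 ℝ Ω) x * φ x = 0 := by
  rw [← integral_zero E3 ℝ (μ := volume.restrict Ω)]
  refine integral_congr_ae ?_
  filter_upwards [Lp.coeFn_zero ℝ 2 (volume.restrict Ω)] with x hx
  rw [hx, Pi.zero_apply, zero_mul]

theorem integral_inner_zero {Ω : Set E3} (φ : E3 → ℝ) :
    ∫ x in Ω, inner ℝ ((0 : L2 E3 Ω) x) (gradient φ x) = 0 := by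
  simpa using integral_inner_smul (Ω := Ω) 0 0 φ

theorem IsWeakDiv.add {Ω : Set E3} {w w' : L2 E3 Ω} {d d' : L2 ℝ Ω} (h : IsWeakDiv Ω w d)
    (h' : IsWeakDiv Ω w' d') : IsWeakDiv Ω (w + w') (d + d') := by
  intro φ hφ hc hs
  rw [integral_inner_add w w' hφ hc, h φ hφ hc hs, h' φ hφ hc hs, ← neg_add,
    ← integral_add (integrable_mul_test d hφ hc) (integrable_mul_test d' hφ hc)]
  refine congrArg _ (integral_congr_ae ?_)
  filter_upwards [Lp.coeFn_add d d'] with x hx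
  rw [hx, Pi.add_apply, add_mul]

theorem IsWeakDiv.smul {Ω : Set E3} {w : L2 E3 Ω} {d : L2 ℝ Ω} (r : ℝ) (h : IsWeakDiv Ω w d) :
    IsWeakDiv Ω (r • w) (r • d) := by
  intro φ hφ hc hs
  rw [integral_inner_smul, h φ hφ hc hs, mul_neg, ← integral_const_mul]
  refine congrArg _ (integral_congr_ae ?_)
  filter_upwards [Lp.coeFn_smul r d] with x hx
  rw [hx, Pi.smul_apply, smul_eq_mul, mul_assoc]

theorem isWeakDiv_zero {Ω : Set E3} : IsWeakDiv Ω 0 0 := by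
  intro φ _ _ _
  rw [integral_inner_zero, integral_zero_mul, neg_zero]

/-! ### Meshes -/

/-- A conforming tetrahedral partition of (the closure of) `Ω`: a finite simplicial complex all of
whose faces lie in tetrahedra of the complex, with underlying space `closure Ω`. -/
structure TetMesh (Ω : Set E3) where
  complex : Geometry.SimplicialComplex ℝ E3
  finite_faces : complex.faces.Finite
  pure : ∀ s ∈ complex.faces, ∃ t ∈ complex.faces, s ⊆ t ∧ t.card = 4
  space_eq : complex.space = closure Ω

namespace TetMesh

variable {Ω : Set E3} (T : TetMesh Ω)

/-- The tetrahedra of the mesh, given by their four vertices. -/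
def Tet : Type := {K : Finset E3 // K ∈ T.complex.faces ∧ K.card = 4}

variable {T} in
/-- The closed tetrahedron. -/
def Tet.carrier (K : T.Tet) : Set E3 := convexHull ℝ (K.1 : Set E3)

instance : Finite T.Tet :=
  (T.finite_faces.subset (fun _ h => h.1 : {K | K ∈ T.complex.faces ∧ K.card = 4} ⊆ _)).to_subtype

variable {T} in
/-- The vertices of a tetrahedron as an affine basis; its coordinates are the barycentric
coordinates. -/
def Tet.basis (K : T.Tet) : AffineBasis K.1 ℝ E3 where
  toFun := Subtype.val
  ind' := T.complex.indep K.2.1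
  tot' := by
    rw [(T.complex.indep K.2.1).affineSpan_eq_top_iff_card_eq_finrank_add_one]
    simp [K.2.2]

variable {T} in
/-- The bubble function of a tetrahedron: the product of its four barycentric coordinates. -/
def Tet.bubble (K : T.Tet) (x : E3) : ℝ := ∏ v : K.1, K.basis.coord v x

theorem exists_mem_carrier {x : E3} (hx : x ∈ closure Ω) : ∃ K : T.Tet, x ∈ K.carrier := by
  rw [← T.space_eq, Geometry.SimplicialComplex.mem_space_iff] at hx
  obtain ⟨s, hs, hxs⟩ := hx
  obtain ⟨t, ht, hst, hc⟩ := T.pure s hs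
  exact ⟨⟨t, ht, hc⟩, convexHull_mono (by exact_mod_cast hst) hxs⟩

theorem isCompact_closure (T : TetMesh Ω) : IsCompact (closure Ω) := by
  rw [← T.space_eq]
  exact T.finite_faces.isCompact_biUnion fun s _ => s.finite_toSet.isCompact_convexHull (𝕜 := ℝ)

theorem memLp_of_continuousOn (T : TetMesh Ω) {F : Type*} [NormedAddCommGroup F] {f : E3 → F}
    (hf : ContinuousOn f (closure Ω)) : MemLp f 2 (volume.restrict Ω) := by
  have hK : IsCompact (closure Ω) := T.isCompact_closure
  have : IsFiniteMeasure (volume.restrict (closure Ω)) := ⟨by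
    rw [Measure.restrict_apply_univ]; exact hK.measure_lt_top⟩
  obtain ⟨C, hC⟩ := hK.exists_bound_of_continuousOn hf
  refine MemLp.mono_measure (Measure.restrict_mono subset_closure le_rfl)
    (MemLp.of_bound (hf.aestronglyMeasurable isClosed_closure.measurableSet) C ?_)
  exact (ae_restrict_iff' isClosed_closure.measurableSet).2 (Filter.Eventually.of_forall hC)

theorem integrable_of_continuousOn (T : TetMesh Ω) {f : E3 → ℝ} (hf : ContinuousOn f (closure Ω)) :
    Integrable f (volume.restrict Ω) :=
  (hf.integrableOn_compact T.isCompact_closure).mono_set subset_closure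

/-! ### Continuous finite element spaces

A finite element function lives on `closure Ω`; it is identified with its extension by zero. -/

/-- Continuous piecewise affine functions (`P₁` Lagrange elements), the space `W_h` for `σ`. -/
def W : Submodule ℝ (E3 → ℝ) where
  carrier := {f | ContinuousOn f (closure Ω) ∧ (∀ x ∉ closure Ω, f x = 0) ∧
    ∀ K : T.Tet, ∃ a : E3 →ᵃ[ℝ] ℝ, ∀ x ∈ K.carrier, f x = a x}
  add_mem' := by
    rintro f g ⟨hf, hf0, hfK⟩ ⟨hg, hg0, hgK⟩
    refine ⟨hf.add hg, fun x hx => by simp [hf0 x hx, hg0 x hx], fun K => ?_⟩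
    obtain ⟨a, ha⟩ := hfK K
    obtain ⟨b, hb⟩ := hgK K
    exact ⟨a + b, fun x hx => by simp [ha x hx, hb x hx]⟩
  zero_mem' := ⟨continuousOn_const, fun _ _ => rfl, fun _ => ⟨0, fun _ _ => rfl⟩⟩
  smul_mem' := by
    rintro c f ⟨hf, hf0, hfK⟩
    refine ⟨hf.const_smul c, fun x hx => by simp [hf0 x hx], fun K => ?_⟩
    obtain ⟨a, ha⟩ := hfK K
    exact ⟨c • a, fun x hx => by simp [ha x hx]⟩

/-- `P₁` functions vanishing on the boundary, the space `F_h ⊆ H¹₀(Ω)` for the temperature. -/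
def F : Submodule ℝ (E3 → ℝ) where
  carrier := {f | f ∈ T.W ∧ ∀ x ∈ frontier Ω, f x = 0}
  add_mem' := fun ha hb =>
    ⟨T.W.add_mem ha.1 hb.1, fun x hx => by simp [ha.2 x hx, hb.2 x hx]⟩
  zero_mem' := ⟨T.W.zero_mem, fun _ _ => rfl⟩
  smul_mem' := fun c _ ha => ⟨T.W.smul_mem c ha.1, fun x hx => by simp [ha.2 x hx]⟩

/-- `P₁` functions of mean zero, the space `M_h ⊆ L²₀(Ω)` for the pressure. -/
def M : Submodule ℝ (E3 → ℝ) where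
  carrier := {f | f ∈ T.W ∧ ∫ x in Ω, f x = 0}
  add_mem' := fun {f g} hf hg => ⟨T.W.add_mem hf.1 hg.1, by
    simp only [Pi.add_apply]
    rw [integral_add (T.integrable_of_continuousOn hf.1.1) (T.integrable_of_continuousOn hg.1.1),
      hf.2, hg.2, add_zero]⟩
  zero_mem' := ⟨T.W.zero_mem, by simp⟩
  smul_mem' := fun c f hf => ⟨T.W.smul_mem c hf.1, by
    simp [integral_const_mul, hf.2]⟩

/-- The velocity space `V_h ⊆ H¹₀(Ω)³` of the mini element: continuous vector fields that vanish on
the boundary and are on each tetrahedron the sum of an affine field and a constant multiple of the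
bubble function. -/
def V : Submodule ℝ (E3 → E3) where
  carrier := {u | ContinuousOn u (closure Ω) ∧ (∀ x ∉ closure Ω, u x = 0) ∧
    (∀ x ∈ frontier Ω, u x = 0) ∧
    ∀ K : T.Tet, ∃ (a : E3 →ᵃ[ℝ] E3) (c : E3), ∀ x ∈ K.carrier, u x = a x + K.bubble x • c}
  add_mem' := by
    rintro f g ⟨hf, hf0, hf1, hfK⟩ ⟨hg, hg0, hg1, hgK⟩
    refine ⟨hf.add hg, fun x hx => by simp [hf0 x hx, hg0 x hx],
      fun x hx => by simp [hf1 x hx, hg1 x hx], fun K => ?_⟩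
    obtain ⟨a, c, ha⟩ := hfK K
    obtain ⟨b, d, hb⟩ := hgK K
    refine ⟨a + b, c + d, fun x hx => ?_⟩
    simp only [Pi.add_apply, ha x hx, hb x hx, AffineMap.coe_add, smul_add]
    abel
  zero_mem' := ⟨continuousOn_const, fun _ _ => rfl, fun _ _ => rfl,
    fun _ => ⟨0, 0, fun _ _ => by simp⟩⟩
  smul_mem' := by
    rintro r f ⟨hf, hf0, hf1, hfK⟩
    refine ⟨hf.const_smul r, fun x hx => by simp [hf0 x hx], fun x hx => by simp [hf1 x hx],
      fun K => ?_⟩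
    obtain ⟨a, c, ha⟩ := hfK K
    exact ⟨r • a, r • c, fun x hx => by
      simp [ha x hx, smul_comm r]⟩

/-! ### Raviart-Thomas spaces and the projection of the convecting velocity -/

/-- The coefficients of a local Raviart-Thomas field of order one, `x ↦ p x + s x • x` with `p` and
`s` affine, on each tetrahedron. -/
abbrev RTCoeff : Type := T.Tet → (E3 →ᵃ[ℝ] E3) × (E3 →ᵃ[ℝ] ℝ)

variable {T} in
/-- On each tetrahedron `w` is the Raviart-Thomas polynomial `x ↦ p x + s x • x` with the
coefficients `c`. -/
def AgreesWith (w : L2 E3 Ω) (c : T.RTCoeff) : Prop :=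
  ∀ K : T.Tet, ∀ᵐ x ∂(volume.restrict Ω), x ∈ K.carrier → w x = (c K).1 x + (c K).2 x • x

theorem AgreesWith.add {w w' : L2 E3 Ω} {c c' : T.RTCoeff} (h : AgreesWith w c)
    (h' : AgreesWith w' c') : AgreesWith (w + w') (c + c') := by
  intro K
  filter_upwards [h K, h' K, Lp.coeFn_add w w'] with x h1 h2 h3 hx
  rw [h3, Pi.add_apply, h1 hx, h2 hx]
  simp only [Pi.add_apply, Prod.fst_add, Prod.snd_add, AffineMap.coe_add, add_smul]
  abel

theorem AgreesWith.smul {w : L2 E3 Ω} {c : T.RTCoeff} (r : ℝ) (h : AgreesWith w c) :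
    AgreesWith (r • w) (r • c) := by
  intro K
  filter_upwards [h K, Lp.coeFn_smul r w] with x h1 h3 hx
  rw [h3, Pi.smul_apply, h1 hx]
  simp [smul_smul]

theorem agreesWith_zero : AgreesWith (0 : L2 E3 Ω) (0 : T.RTCoeff) := by
  intro K
  filter_upwards [Lp.coeFn_zero E3 2 (volume.restrict Ω)] with x h1 _
  rw [h1]
  simp

/-- `RT_h`: fields in `H(div, Ω)` that lie in `P₁(K)³ + x P₁(K)` on each tetrahedron `K`. -/
def RT : Submodule ℝ (L2 E3 Ω) where
  carrier := {w | (∃ d : L2 ℝ Ω, IsWeakDiv Ω w d) ∧ ∃ c : T.RTCoeff, AgreesWith w c}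
  add_mem' := by
    rintro w w' ⟨⟨d, hd⟩, c, hc⟩ ⟨⟨d', hd'⟩, c', hc'⟩
    exact ⟨⟨d + d', hd.add hd'⟩, c + c', AgreesWith.add T hc hc'⟩
  zero_mem' := ⟨⟨0, isWeakDiv_zero⟩, 0, agreesWith_zero T⟩
  smul_mem' := by
    rintro r w ⟨⟨d, hd⟩, c, hc⟩
    exact ⟨⟨r • d, hd.smul r⟩, r • c, AgreesWith.smul T r hc⟩

/-- `RT_{0h}`: fields in `RT_h` with zero divergence in `Ω` and zero normal trace on `∂Ω`. -/
def RT0 : Submodule ℝ (L2 E3 Ω) where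
  carrier := {w | w ∈ T.RT ∧ IsWeakDiv Ω w 0 ∧ HasZeroNormalTrace Ω w 0}
  add_mem' := by
    rintro w w' ⟨h1, h2, h3⟩ ⟨h1', h2', h3'⟩
    refine ⟨T.RT.add_mem h1 h1', by simpa using h2.add h2', fun φ hφ hc => ?_⟩
    have e := h3 φ hφ hc
    have e' := h3' φ hφ hc
    rw [integral_zero_mul, add_zero] at e e' ⊢
    rw [integral_inner_add w w' hφ hc, e, e', add_zero]
  zero_mem' := ⟨T.RT.zero_mem, isWeakDiv_zero, fun φ _ _ => by
    rw [integral_inner_zero, integral_zero_mul, add_zero]⟩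
  smul_mem' := by
    rintro r w ⟨h1, h2, h3⟩
    refine ⟨T.RT.smul_mem r h1, by simpa using h2.smul r, fun φ hφ hc => ?_⟩
    have e := h3 φ hφ hc
    rw [integral_zero_mul, add_zero] at e ⊢
    rw [integral_inner_smul, e, mul_zero]

instance : FiniteDimensional ℝ T.RT0 := by
  let R : Submodule ℝ (L2 E3 Ω × T.RTCoeff) :=
    { carrier := {z | AgreesWith z.1 z.2}
      add_mem' := fun h h' => AgreesWith.add T h h'
      zero_mem' := agreesWith_zero T
      smul_mem' := fun r _ h => AgreesWith.smul T r h }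
  have hinj : Function.Injective ((LinearMap.snd ℝ (L2 E3 Ω) T.RTCoeff).comp R.subtype) := by
    rw [← LinearMap.ker_eq_bot, LinearMap.ker_eq_bot']
    rintro ⟨⟨w, c⟩, hz⟩ h0
    have hc : c = 0 := h0
    subst hc
    have hw : w = 0 := by
      apply Lp.ext
      have hall : ∀ᵐ x ∂(volume.restrict Ω), ∀ K : T.Tet, x ∈ K.carrier → w x = 0 := by
        rw [ae_all_iff]
        intro K
        filter_upwards [hz K] with x hx hK
        simpa using hx hK
      have hmem : ∀ᵐ x ∂(volume.restrict Ω), x ∈ closure Ω :=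
        ae_restrict_of_ae_restrict_of_subset subset_closure
          (ae_restrict_mem isClosed_closure.measurableSet)
      filter_upwards [hall, hmem, Lp.coeFn_zero E3 2 (volume.restrict Ω)] with x h1 h2 h3
      obtain ⟨K, hK⟩ := T.exists_mem_carrier h2
      rw [h1 K hK, h3, Pi.zero_apply]
    subst hw
    rfl
  have : FiniteDimensional ℝ R := FiniteDimensional.of_injective _ hinj
  have hle : T.RT0 ≤ R.map (LinearMap.fst ℝ (L2 E3 Ω) T.RTCoeff) := by
    rintro w ⟨⟨_, c, hc⟩, _⟩
    exact ⟨(w, c), hc, rfl⟩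
  exact Submodule.finiteDimensional_of_le hle

/-- The `L²(Ω)³`-orthogonal projection `P_{0h}` onto `RT_{0h}`, applied to a discrete velocity. -/
def P0 (u : T.V) : L2 E3 Ω :=
  T.RT0.starProjection ((T.memLp_of_continuousOn u.2.1).toLp (u : E3 → E3))

/-! ### The scheme -/

/-- One step of the linearized backward Euler mixed finite element scheme with viscosity `μ`,
conductivity `κ`, step size `τ` and data `f`, `g` at the new time level: from `(σ₀, u₀, θ₀)` at the
old time level to `(σ, u, p, θ)` at the new one; `ρ = σ²`. -/
structure IsStep (μ κ τ : ℝ) (f : E3 → E3) (g : E3 → ℝ) (σ₀ : T.W) (u₀ : T.V) (θ₀ : T.F)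
    (σ : T.W) (u : T.V) (p : T.M) (θ : T.F) : Prop where
  density : ∀ r : T.W,
    ip Ω (fun x => (σ.1 x - σ₀.1 x) / τ) r.1
      + ip Ω (fun x => inner ℝ (gradient σ.1 x) (T.P0 u₀ x)) r.1 = 0
  momentum : ∀ (v : T.V) (q : T.M),
    ip Ω (fun x => σ.1 x • τ⁻¹ • (σ.1 x • u.1 x - σ₀.1 x • u₀.1 x)) v.1
      + μ * ip Ω (vgrad u.1) (vgrad v.1)
      + ip Ω (fun x => (σ.1 x) ^ 2 • fderiv ℝ u.1 x (u₀.1 x)) v.1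
      + 1 / 2 * ip Ω (fun x => divg (fun y => (σ.1 y) ^ 2 • u₀.1 y) x • u.1 x) v.1
      - ip Ω (divg v.1) p.1 + ip Ω (divg u.1) q.1
    = ip Ω f v.1
  temperature : ∀ w : T.F,
    ip Ω (fun x => σ.1 x * ((σ.1 x * θ.1 x - σ₀.1 x * θ₀.1 x) / τ)) w.1
      + κ * ip Ω (gradient θ.1) (gradient w.1)
      + ip Ω (fun x => (σ.1 x) ^ 2 * fderiv ℝ θ.1 x (u₀.1 x)) w.1
      + 1 / 2 * ip Ω (fun x => θ.1 x * divg (fun y => (σ.1 y) ^ 2 • u₀.1 y) x) w.1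
    = ip Ω g w.1

end TetMesh

end FEM

end

/-!
All functions of the scheme are bounded and Lipschitz on the closed convex domain: they are
continuous and, on each of the finitely many closed tetrahedra, restrictions of smooth functions,
so a segment argument glues the local Lipschitz bounds together
(`TetMesh.lipBdd_of_piecewise`). By Rademacher's theorem they are differentiable almost everywhere,
and the divergence theorem holds for those that vanish on the boundary
(`integral_fderiv_eq_zero`); no integral over a face of the mesh is ever needed. Three facts follow.

* Convection drops out of the energy. In the momentum and temperature equations, the convection
  term and its stabilization are skew-symmetric since the convecting velocity vanishes on the
  boundary (`convection_self_eq_zero`). In the density equation, the projected velocity is only an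
  `L²` field with zero divergence and zero normal trace, in the sense of smooth test functions;
  mollification extends this to the Lipschitz test function `σ²`
  (`HasZeroNormalTrace.integral_fderiv_eq_zero`, `transport_self_eq_zero`).
* The Poincaré inequality `‖u‖² ≤ 4 R² ‖∇u‖²` holds when `Ω` lies in the ball of radius `R`
  (`poincare`); this gives the constant `C = 4 R²`.
* A discrete pressure orthogonal to all divergences vanishes: bubble test fields show that its
  gradient is zero on each tetrahedron (`TetMesh.pressure_eq_zero`).

The step consists of three square linear systems, to be solved one after the other, for `σ`, for
`(u, p)` and for `θ`. Testing each homogeneous system with its own solution shows that its kernel is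
trivial, so it is uniquely solvable (`TetMesh.step_existsUnique`). Testing the full equations with
the solution, and absorbing the forcing by Young's and Poincaré's inequalities, gives the energy
estimate of one step (`energy_estimate`), and the sum over the steps telescopes. The second velocity
bound is twice the first with one copy of the nonnegative term `‖σ u‖²` dropped.
-/

namespace FEM

/-! ### Convex polyhedral domains -/

namespace IsConvexPolyhedralDomain

variable {Ω : Set E3}

theorem isOpen (hΩ : IsConvexPolyhedralDomain Ω) : IsOpen Ω := by
  obtain ⟨-, S, rfl⟩ := hΩ
  exact isOpen_interior

theorem convex (hΩ : IsConvexPolyhedralDomain Ω) : Convex ℝ Ω := by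
  obtain ⟨-, S, rfl⟩ := hΩ
  exact (convex_convexHull ℝ _).interior

theorem isCompact_closure (hΩ : IsConvexPolyhedralDomain Ω) : IsCompact (closure Ω) := by
  obtain ⟨-, S, rfl⟩ := hΩ
  have hS : IsCompact (convexHull ℝ (S : Set E3)) := S.finite_toSet.isCompact_convexHull (𝕜 := ℝ)
  exact hS.closure_of_subset interior_subset

theorem isFiniteMeasure (hΩ : IsConvexPolyhedralDomain Ω) :
    IsFiniteMeasure (volume.restrict Ω) := ⟨by
  rw [Measure.restrict_apply_univ]
  exact (measure_mono subset_closure).trans_lt hΩ.isCompact_closure.measure_lt_top⟩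

theorem volume_pos (hΩ : IsConvexPolyhedralDomain Ω) : 0 < volume Ω :=
  hΩ.isOpen.measure_pos volume hΩ.1

theorem interior_closure (hΩ : IsConvexPolyhedralDomain Ω) : interior (closure Ω) = Ω := by
  have h := hΩ.convex.interior_closure_eq_interior_of_nonempty_interior
    (by rw [hΩ.isOpen.interior_eq]; exact hΩ.1)
  rw [h, hΩ.isOpen.interior_eq]

/-- The boundary of a convex set is null, so almost every point lies in `Ω` or is interior to its
complement. -/
theorem ae_mem_or_notMem_closure (hΩ : IsConvexPolyhedralDomain Ω) :
    ∀ᵐ x : E3, x ∈ Ω ∨ x ∉ closure Ω := by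
  have h : volume (frontier Ω) = 0 := hΩ.convex.addHaar_frontier volume
  filter_upwards [measure_eq_zero_iff_ae_notMem.1 h] with x hx
  by_contra! hc
  exact hx (by rw [hΩ.isOpen.frontier_eq]; exact ⟨hc.2, hc.1⟩)

theorem exists_radius (hΩ : IsConvexPolyhedralDomain Ω) :
    ∃ R : ℝ, 0 < R ∧ ∀ x ∈ closure Ω, ‖x‖ ≤ R := by
  obtain ⟨R, hR⟩ := hΩ.isCompact_closure.isBounded.exists_norm_le
  exact ⟨max R 1, by positivity, fun x hx => (hR x hx).trans (le_max_left _ _)⟩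

end IsConvexPolyhedralDomain

/-! ### Bounded Lipschitz functions -/

section LipBdd

variable {Ω : Set E3}
variable {F G H : Type*} [NormedAddCommGroup F] [NormedSpace ℝ F] [NormedAddCommGroup G]
  [NormedSpace ℝ G] [NormedAddCommGroup H] [NormedSpace ℝ H]

/-- `f` is bounded and Lipschitz on `closure Ω`; one constant serves for both bounds. -/
def LipBdd (Ω : Set E3) (f : E3 → F) : Prop :=
  ∃ C : ℝ, 0 ≤ C ∧ (∀ x ∈ closure Ω, ∀ y ∈ closure Ω, ‖f x - f y‖ ≤ C * ‖x - y‖) ∧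
    ∀ x ∈ closure Ω, ‖f x‖ ≤ C

namespace LipBdd

theorem add {F : Type*} [NormedAddCommGroup F] {f g : E3 → F} (hf : LipBdd Ω f) (hg : LipBdd Ω g) :
    LipBdd Ω (fun x => f x + g x) := by
  obtain ⟨C, hC, h1, h2⟩ := hf
  obtain ⟨D, hD, k1, k2⟩ := hg
  refine ⟨C + D, by positivity, fun x hx y hy => ?_, fun x hx => ?_⟩
  · have := norm_add_le (f x - f y) (g x - g y)
    rw [show f x + g x - (f y + g y) = (f x - f y) + (g x - g y) by abel]
    linarith [h1 x hx y hy, k1 x hx y hy]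
  · exact (norm_add_le _ _).trans (add_le_add (h2 x hx) (k2 x hx))

theorem bilin {f : E3 → F} {g : E3 → G} (B : F →L[ℝ] G →L[ℝ] H) (hf : LipBdd Ω f)
    (hg : LipBdd Ω g) : LipBdd Ω (fun x => B (f x) (g x)) := by
  obtain ⟨C, hC, h1, h2⟩ := hf
  obtain ⟨D, hD, k1, k2⟩ := hg
  refine ⟨2 * (‖B‖ * C * D), by positivity, fun x hx y hy => ?_, fun x hx => ?_⟩
  · have e : B (f x) (g x) - B (f y) (g y) = B (f x - f y) (g x) + B (f y) (g x - g y) := by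
      simp
    have a1 : ‖B (f x - f y) (g x)‖ ≤ ‖B‖ * (C * ‖x - y‖) * D :=
      (B.le_opNorm₂ _ _).trans (by gcongr; exacts [h1 x hx y hy, k2 x hx])
    have a2 : ‖B (f y) (g x - g y)‖ ≤ ‖B‖ * C * (D * ‖x - y‖) :=
      (B.le_opNorm₂ _ _).trans (by gcongr; exacts [h2 y hy, k1 x hx y hy])
    rw [e]
    linarith [norm_add_le (B (f x - f y) (g x)) (B (f y) (g x - g y))]
  · have a1 : ‖B (f x) (g x)‖ ≤ ‖B‖ * C * D :=
      (B.le_opNorm₂ _ _).trans (by gcongr; exacts [h2 x hx, k2 x hx])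
    have : 0 ≤ ‖B‖ * C * D := by positivity
    linarith

theorem smul {f : E3 → ℝ} {g : E3 → G} (hf : LipBdd Ω f) (hg : LipBdd Ω g) :
    LipBdd Ω (fun x => f x • g x) :=
  hf.bilin (ContinuousLinearMap.lsmul ℝ ℝ) hg

theorem mul {f g : E3 → ℝ} (hf : LipBdd Ω f) (hg : LipBdd Ω g) :
    LipBdd Ω (fun x => f x * g x) :=
  hf.smul hg

theorem sq {f : E3 → ℝ} (hf : LipBdd Ω f) : LipBdd Ω (fun x => f x ^ 2) := by
  simpa only [pow_two] using hf.mul hf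

theorem inner {G : Type*} [NormedAddCommGroup G] [InnerProductSpace ℝ G] {f g : E3 → G}
    (hf : LipBdd Ω f) (hg : LipBdd Ω g) : LipBdd Ω (fun x => inner ℝ (f x) (g x)) :=
  hf.bilin (innerSL ℝ) hg

theorem const {F : Type*} [NormedAddCommGroup F] (c : F) : LipBdd Ω (fun _ => c) :=
  ⟨‖c‖, norm_nonneg _, fun x _ y _ => by simp; positivity, fun _ _ => le_rfl⟩

theorem identity (hΩ : IsConvexPolyhedralDomain Ω) : LipBdd Ω (fun x : E3 => x) := by
  obtain ⟨R, hR, hR'⟩ := hΩ.exists_radius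
  exact ⟨R + 1, by positivity, fun x _ y _ => by nlinarith [norm_nonneg (x - y)],
    fun x hx => by linarith [hR' x hx]⟩

theorem clm (L : F →L[ℝ] G) {f : E3 → F} (hf : LipBdd Ω f) : LipBdd Ω (fun x => L (f x)) :=
  (const L).bilin (ContinuousLinearMap.id ℝ (F →L[ℝ] G)) hf

theorem lipschitzOnWith {F : Type*} [NormedAddCommGroup F] {f : E3 → F} (hf : LipBdd Ω f) :
    ∃ C, LipschitzOnWith C f (closure Ω) := by
  obtain ⟨C, -, h1, -⟩ := hf
  exact ⟨C.toNNReal, LipschitzOnWith.of_dist_le' fun x hx y hy => by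
    simpa [dist_eq_norm] using h1 x hx y hy⟩

theorem continuousOn {F : Type*} [NormedAddCommGroup F] {f : E3 → F} (hf : LipBdd Ω f) :
    ContinuousOn f (closure Ω) :=
  hf.lipschitzOnWith.choose_spec.continuousOn

theorem memLp_top {F : Type*} [NormedAddCommGroup F] {f : E3 → F} (hf : LipBdd Ω f)
    (hΩ : IsConvexPolyhedralDomain Ω) :
    MemLp f ⊤ (volume.restrict Ω) := by
  have := hf.continuousOn.mono subset_closure
  obtain ⟨C, -, -, h2⟩ := hf
  refine memLp_top_of_bound (this.aestronglyMeasurable hΩ.isOpen.measurableSet) C ?_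
  exact (ae_restrict_iff' hΩ.isOpen.measurableSet).2
    (Filter.Eventually.of_forall fun x hx => h2 x (subset_closure hx))

/-- Rademacher's theorem. -/
theorem ae_differentiableAt [FiniteDimensional ℝ F] {f : E3 → F} (hf : LipBdd Ω f)
    (hΩ : IsConvexPolyhedralDomain Ω) :
    ∀ᵐ x ∂(volume.restrict Ω), DifferentiableAt ℝ f x := by
  obtain ⟨C, hC⟩ := hf.lipschitzOnWith
  have h := (hC.mono subset_closure).ae_differentiableWithinAt (μ := volume)
    hΩ.isOpen.measurableSet
  filter_upwards [h, ae_restrict_mem hΩ.isOpen.measurableSet] with x hx hxΩ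
  exact hx.differentiableAt (hΩ.isOpen.mem_nhds hxΩ)

theorem fderiv_memLp_top [FiniteDimensional ℝ F] {f : E3 → F} (hf : LipBdd Ω f)
    (hΩ : IsConvexPolyhedralDomain Ω) : MemLp (fderiv ℝ f) ⊤ (volume.restrict Ω) := by
  have := FiniteDimensional.complete ℝ F
  obtain ⟨C, hC⟩ := hf.lipschitzOnWith
  refine memLp_top_of_bound (measurable_fderiv ℝ f).aestronglyMeasurable C ?_
  filter_upwards [ae_restrict_mem hΩ.isOpen.measurableSet] with x hxΩ
  exact norm_fderiv_le_of_lipschitzOn ℝ (hΩ.isOpen.mem_nhds hxΩ) (hC.mono subset_closure)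

/-- The extension by zero of a Lipschitz function on `closure Ω` that vanishes on the boundary is
Lipschitz on the whole space: a segment that leaves `Ω` crosses the boundary. -/
theorem lipschitzWith {F : Type*} [NormedAddCommGroup F] {f : E3 → F} (hf : LipBdd Ω f)
    (hΩ : IsConvexPolyhedralDomain Ω)
    (h0 : ∀ x ∉ Ω, f x = 0) : ∃ C, LipschitzWith C f := by
  obtain ⟨C, hC, h1, -⟩ := hf
  have key : ∀ x ∈ Ω, ∀ y ∉ Ω, ‖f x‖ ≤ C * ‖x - y‖ := by
    intro x hx y hy
    obtain ⟨z, hz, hzf⟩ : ∃ z ∈ segment ℝ x y, z ∈ frontier Ω := by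
      rw [hΩ.isOpen.frontier_eq]
      by_contra! hc
      obtain ⟨z, -, hz1, hz2⟩ := (convex_segment (𝕜 := ℝ) x y).isPreconnected Ω (closure Ω)ᶜ
        hΩ.isOpen isClosed_closure.isOpen_compl
        (fun z hz => (em (z ∈ Ω)).imp id fun h h' => hc z hz ⟨h', h⟩)
        ⟨x, left_mem_segment ℝ x y, hx⟩
        ⟨y, right_mem_segment ℝ x y, fun h => hc y (right_mem_segment ℝ x y) ⟨h, hy⟩⟩
      exact hz2 (subset_closure hz1)
    have hzΩ : z ∉ Ω := by
      rw [hΩ.isOpen.frontier_eq] at hzf; exact hzf.2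
    have := h1 x (subset_closure hx) z hzf.1
    rw [h0 z hzΩ, sub_zero] at this
    refine this.trans ?_
    have hd := dist_add_dist_of_mem_segment hz
    simp only [dist_eq_norm] at hd
    gcongr
    linarith [norm_nonneg (z - y)]
  refine ⟨C.toNNReal, LipschitzWith.of_dist_le' fun x y => ?_⟩
  simp only [dist_eq_norm]
  by_cases hx : x ∈ Ω <;> by_cases hy : y ∈ Ω
  · exact h1 x (subset_closure hx) y (subset_closure hy)
  · simpa [h0 y hy] using key x hx y hy
  · simpa [h0 x hx, norm_sub_rev] using key y hy x hx
  · simp [h0 x hx, h0 y hy]; positivity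

end LipBdd

/-- The divergence theorem for Lipschitz functions vanishing on the boundary, one partial
derivative at a time. -/
theorem integral_fderiv_eq_zero {f : E3 → ℝ} (hf : LipBdd Ω f) (hΩ : IsConvexPolyhedralDomain Ω)
    (h0 : ∀ x ∉ Ω, f x = 0) (v : E3) : ∫ x in Ω, fderiv ℝ f x v = 0 := by
  obtain ⟨C, hC⟩ := hf.lipschitzWith hΩ h0
  have hsupp : HasCompactSupport f := HasCompactSupport.intro hΩ.isCompact_closure
    fun x hx => h0 x fun h => hx (subset_closure h)
  have h := (LipschitzWith.const (1 : ℝ) : LipschitzWith 0 (fun _ : E3 => (1 : ℝ)))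
    |>.integral_lineDeriv_mul_eq (μ := volume) hC hsupp (-v)
  simp only [lineDeriv, deriv_const, zero_mul, integral_zero, neg_neg, mul_one] at h
  change 0 = ∫ x, lineDeriv ℝ f x v at h
  rw [← integral_indicator hΩ.isOpen.measurableSet, h]
  refine integral_congr_ae ?_
  filter_upwards [hΩ.ae_mem_or_notMem_closure, hC.ae_differentiableAt (μ := volume)] with x hx hd
  rw [hd.lineDeriv_eq_fderiv]
  by_cases hxΩ : x ∈ Ω
  · rw [Set.indicator_of_mem hxΩ]
  · rw [Set.indicator_of_notMem hxΩ]
    have hc : x ∉ closure Ω := hx.resolve_left hxΩ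
    have : f =ᶠ[nhds x] fun _ => 0 := by
      filter_upwards [isClosed_closure.isOpen_compl.mem_nhds hc] with y hy
      exact h0 y fun h => hy (subset_closure h)
    rw [this.fderiv_eq]
    simp

end LipBdd

/-! ### Fields of zero divergence and zero normal trace against Lipschitz functions -/

/-- Differentiation commutes with mollification of a Lipschitz function. -/
theorem fderiv_convolution_normed {g : E3 → ℝ} {C : NNReal} (hg : LipschitzWith C g)
    (φ : ContDiffBump (0 : E3)) (x v : E3) :
    fderiv ℝ (convolution (φ.normed volume) g (ContinuousLinearMap.lsmul ℝ ℝ) volume) x v =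
      convolution (φ.normed volume) (fun y => lineDeriv ℝ g y v)
        (ContinuousLinearMap.lsmul ℝ ℝ) volume x := by
  have hφ1 : ContDiff ℝ 1 (φ.normed volume) := φ.contDiff_normed (n := 1)
  have hφc : HasCompactSupport (φ.normed volume) := φ.hasCompactSupport_normed
  obtain ⟨D, hD⟩ := hφ1.lipschitzWith_of_hasCompactSupport hφc one_ne_zero
  have hk : LipschitzWith C fun y => g (x - y) := LipschitzWith.of_dist_le_mul fun a b => by
    simpa only [dist_sub_left] using hg.dist_le_mul (x - a) (x - b)
  have hint : ConvolutionExistsAt (fderiv ℝ (φ.normed volume)) g x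
      ((ContinuousLinearMap.lsmul ℝ ℝ).precompL E3) volume :=
    (hφc.fderiv (𝕜 := ℝ)).convolutionExists_left _ (hφ1.continuous_fderiv one_ne_zero)
      hg.continuous.locallyIntegrable x
  rw [(hφc.hasFDerivAt_convolution_left _ hφ1 hg.continuous.locallyIntegrable x).fderiv,
    convolution, ContinuousLinearMap.integral_apply (φ := fun t =>
      (ContinuousLinearMap.lsmul ℝ ℝ).precompL E3 (fderiv ℝ (φ.normed volume) t) (g (x - t))) hint]
  simp only [convolution, ContinuousLinearMap.precompL_apply, ContinuousLinearMap.lsmul_apply,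
    smul_eq_mul]
  have h := hk.integral_lineDeriv_mul_eq (μ := volume) hD hφc (-v)
  simp only [neg_neg] at h
  have e1 : ∀ y, lineDeriv ℝ (φ.normed volume) y v = fderiv ℝ (φ.normed volume) y v := fun y =>
    (hφ1.differentiable one_ne_zero y).lineDeriv_eq_fderiv
  have e2 : ∀ y, lineDeriv ℝ (fun y => g (x - y)) y (-v) = lineDeriv ℝ g (x - y) v := fun y => by
    simp only [lineDeriv]
    congr 1
    ext t
    congr 1
    simp only [smul_neg]
    abel
  simp only [e1, e2] at h
  rw [← h]
  exact integral_congr_ae (Filter.Eventually.of_forall fun y => mul_comm _ _)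

theorem abs_fderiv_convolution_normed_le {g : E3 → ℝ} {C : NNReal} (hg : LipschitzWith C g)
    (φ : ContDiffBump (0 : E3)) (x v : E3) :
    |fderiv ℝ (convolution (φ.normed volume) g (ContinuousLinearMap.lsmul ℝ ℝ) volume) x v| ≤
      C * ‖v‖ := by
  rw [fderiv_convolution_normed hg, convolution]
  have h := norm_integral_le_of_norm_le (μ := volume)
    (f := fun y => ContinuousLinearMap.lsmul ℝ ℝ (φ.normed volume y) (lineDeriv ℝ g (x - y) v))
    (g := fun y => φ.normed volume y * (C * ‖v‖)) (φ.integrable_normed.mul_const _)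
    (Filter.Eventually.of_forall fun y => by
      simp only [ContinuousLinearMap.lsmul_apply, norm_smul]
      rw [Real.norm_of_nonneg (φ.nonneg_normed y)]
      exact mul_le_mul_of_nonneg_left (norm_lineDeriv_le_of_lipschitz ℝ hg)
        (φ.nonneg_normed y))
  rwa [integral_mul_const, φ.integral_normed, one_mul] at h

/-- A Lipschitz function on the closed domain is the restriction of a compactly supported Lipschitz
function. -/
theorem LipBdd.exists_extension {Ω : Set E3} {f : E3 → ℝ} (hf : LipBdd Ω f)
    (hΩ : IsConvexPolyhedralDomain Ω) :
    ∃ (C : NNReal) (g : E3 → ℝ), LipschitzWith C g ∧ HasCompactSupport g ∧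
      ∀ x ∈ closure Ω, f x = g x := by
  classical
  obtain ⟨C, hC, h1, h2⟩ := hf
  obtain ⟨R, hR, hb⟩ := hΩ.exists_radius
  -- Prescribe zero outside the ball of radius `R + 1`, at distance at least one from the domain.
  let S : Set E3 := closure Ω ∪ {x | R + 1 ≤ ‖x‖}
  let k : E3 → ℝ := fun x => if x ∈ closure Ω then f x else 0
  have key : ∀ x ∈ closure Ω, ∀ y ∉ closure Ω, R + 1 ≤ ‖y‖ → |f x| ≤ C * ‖x - y‖ := by
    intro x hx y _ hy
    have : 1 ≤ ‖x - y‖ := by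
      have := norm_sub_norm_le y x
      rw [norm_sub_rev] at this
      linarith [hb x hx]
    exact (h2 x hx).trans (le_mul_of_one_le_right hC this)
  have hk : LipschitzOnWith C.toNNReal k S := LipschitzOnWith.of_dist_le' fun x hx y hy => by
    rw [Real.dist_eq, dist_eq_norm]
    by_cases hxc : x ∈ closure Ω <;> by_cases hyc : y ∈ closure Ω
    · simpa [k, hxc, hyc] using h1 x hxc y hyc
    · simpa [k, hxc, hyc] using key x hxc y hyc (hy.resolve_left hyc)
    · simpa [k, hxc, hyc, norm_sub_rev] using key y hyc x hxc (hx.resolve_left hxc)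
    · simp [k, hxc, hyc]; positivity
  obtain ⟨g, hg, hgk⟩ := hk.extend_real
  refine ⟨_, g, hg, HasCompactSupport.intro (isCompact_closedBall (0 : E3) (R + 1)) ?_, ?_⟩
  · intro x hx
    have hx' : R + 1 < ‖x‖ := by simpa using hx
    rw [← hgk (Or.inr hx'.le)]
    have : x ∉ closure Ω := fun h => by linarith [hb x h]
    simp [k, this]
  · intro x hx
    rw [← hgk (Or.inl hx)]
    simp [k, hx]

theorem fderiv_apply_eq_sum {h : E3 → ℝ} (x w : E3) :
    fderiv ℝ h x w = ∑ i : Fin 3, w i * fderiv ℝ h x (EuclideanSpace.single i 1) := by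
  have e : w = ∑ i : Fin 3, w i • EuclideanSpace.single i (1 : ℝ) := by
    simpa using ((EuclideanSpace.basisFun (Fin 3) ℝ).sum_repr w).symm
  conv_lhs => rw [e]
  simp

/-- The vanishing normal trace, which is defined with smooth test functions, extends by
mollification to Lipschitz ones. -/
theorem HasZeroNormalTrace.integral_fderiv_eq_zero {Ω : Set E3} {w : L2 E3 Ω}
    (hw : HasZeroNormalTrace Ω w 0) (hΩ : IsConvexPolyhedralDomain Ω) {f : E3 → ℝ}
    (hf : LipBdd Ω f) : ∫ x in Ω, fderiv ℝ f x (w x) = 0 := by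
  have := hΩ.isFiniteMeasure
  obtain ⟨C, g, hg, hgc, hfg⟩ := hf.exists_extension hΩ
  -- The ratio of the radii stays bounded, as the differentiation theorem for mollifiers requires.
  let φ : ℕ → ContDiffBump (0 : E3) := fun n =>
    { rIn := 1 / ((n : ℝ) + 1), rOut := 2 / ((n : ℝ) + 1), rIn_pos := by positivity
      rIn_lt_rOut := by gcongr; norm_num }
  let ψ : ℕ → E3 → ℝ := fun n =>
    convolution ((φ n).normed volume) g (ContinuousLinearMap.lsmul ℝ ℝ) volume
  have hzero : ∀ n, ∫ x in Ω, fderiv ℝ (ψ n) x (w x) = 0 := by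
    intro n
    have h1 : ContDiff ℝ ∞ (ψ n) := (φ n).hasCompactSupport_normed.contDiff_convolution_left _
      ((φ n).contDiff_normed (n := ⊤)) hg.continuous.locallyIntegrable
    have h2 : HasCompactSupport (ψ n) := (φ n).hasCompactSupport_normed.convolution _ hgc
    have h := hw (ψ n) h1 h2
    rw [integral_zero_mul, add_zero] at h
    simpa only [inner_gradient_right, RCLike.conj_to_real, conj_trivial] using h
  have hconv : ∀ i : Fin 3, ∀ᵐ x : E3, Filter.Tendsto
      (fun n => fderiv ℝ (ψ n) x (EuclideanSpace.single i 1)) Filter.atTop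
      (nhds (lineDeriv ℝ g x (EuclideanSpace.single i 1))) := by
    intro i
    have hr : Filter.Tendsto (fun n => (φ n).rOut) Filter.atTop (nhds 0) := by
      have := (tendsto_one_div_add_atTop_nhds_zero_nat (𝕜 := ℝ)).const_mul 2
      simpa [φ, div_eq_mul_inv] using this
    have hK : ∀ᶠ n in Filter.atTop, (φ n).rOut ≤ 2 * (φ n).rIn :=
      Filter.Eventually.of_forall fun n => by simp [φ, div_eq_mul_inv]
    have := ContDiffBump.ae_convolution_tendsto_right_of_locallyIntegrable (μ := volume) hr hK
      (hg.locallyIntegrable_lineDeriv (μ := volume) (EuclideanSpace.single i 1))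
    simpa only [ψ, fderiv_convolution_normed hg] using this
  have hwi : Integrable (fun x => w x) (volume.restrict Ω) :=
    (Lp.memLp w).integrable (by norm_num)
  have hlim : Filter.Tendsto (fun n => ∫ x in Ω, fderiv ℝ (ψ n) x (w x)) Filter.atTop
      (nhds (∫ x in Ω, fderiv ℝ f x (w x))) := by
    refine tendsto_integral_of_dominated_convergence (fun x => C * ‖w x‖) (fun n => ?_)
      (hwi.norm.const_mul _) (fun n => Filter.Eventually.of_forall fun x => ?_) ?_
    · exact (ContinuousLinearMap.id ℝ (E3 →L[ℝ] ℝ)).aestronglyMeasurable_comp₂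
        (measurable_fderiv ℝ (ψ n)).aestronglyMeasurable hwi.1
    · exact abs_fderiv_convolution_normed_le hg (φ n) x (w x)
    · filter_upwards [ae_restrict_of_ae (ae_all_iff.2 hconv),
        ae_restrict_mem hΩ.isOpen.measurableSet,
        ae_restrict_of_ae (hg.ae_differentiableAt (μ := volume))] with x hx hxΩ hd
      have e : f =ᶠ[nhds x] g := by
        filter_upwards [hΩ.isOpen.mem_nhds hxΩ] with y hy using hfg y (subset_closure hy)
      rw [e.fderiv_eq]
      simp only [fderiv_apply_eq_sum x (w x)]
      refine tendsto_finsetSum _ fun i _ => ?_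
      rw [← hd.lineDeriv_eq_fderiv]
      exact (hx i).const_mul _
  simp only [hzero] at hlim
  exact (tendsto_nhds_unique tendsto_const_nhds hlim).symm

/-! ### Inner products and partial derivatives -/

section Integrals

variable {Ω : Set E3}
variable {F G : Type*} [NormedAddCommGroup F] [InnerProductSpace ℝ F] [NormedAddCommGroup G]
  [InnerProductSpace ℝ G]

theorem integrable_inner_of_memLp {f g : E3 → F} (hf : MemLp f 2 (volume.restrict Ω))
    (hg : MemLp g 2 (volume.restrict Ω)) :
    Integrable (fun x => inner ℝ (f x) (g x)) (volume.restrict Ω) :=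
  memLp_one_iff_integrable.1 ((innerSL ℝ (E := F)).memLp_of_bilin 1 hf hg)

theorem integrable_normSq {f : E3 → F} (hf : MemLp f 2 (volume.restrict Ω)) :
    Integrable (fun x => ‖f x‖ ^ 2) (volume.restrict Ω) := by
  simpa only [real_inner_self_eq_norm_sq] using integrable_inner_of_memLp hf hf

theorem ip_self (f : E3 → F) : ip Ω f f = normSq Ω f := by
  simp only [ip, normSq, real_inner_self_eq_norm_sq]

theorem normSq_nonneg {E : Type*} [NormedAddCommGroup E] (f : E3 → E) : 0 ≤ normSq Ω f :=
  integral_nonneg fun _ => by positivity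

theorem ip_comm (f g : E3 → F) : ip Ω f g = ip Ω g f := by
  simp only [ip, real_inner_comm]

theorem ip_congr {f f' g g' : E3 → F} (hf : f =ᵐ[volume.restrict Ω] f')
    (hg : g =ᵐ[volume.restrict Ω] g') : ip Ω f g = ip Ω f' g' := by
  refine integral_congr_ae ?_
  filter_upwards [hf, hg] with x h1 h2
  rw [h1, h2]

theorem ip_add_left {f f' g : E3 → F} (hf : MemLp f 2 (volume.restrict Ω))
    (hf' : MemLp f' 2 (volume.restrict Ω)) (hg : MemLp g 2 (volume.restrict Ω)) :
    ip Ω (f + f') g = ip Ω f g + ip Ω f' g := by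
  simp only [ip, Pi.add_apply, inner_add_left]
  exact integral_add (integrable_inner_of_memLp hf hg) (integrable_inner_of_memLp hf' hg)

theorem ip_sub_left {f f' g : E3 → F} (hf : MemLp f 2 (volume.restrict Ω))
    (hf' : MemLp f' 2 (volume.restrict Ω)) (hg : MemLp g 2 (volume.restrict Ω)) :
    ip Ω (f - f') g = ip Ω f g - ip Ω f' g := by
  simp only [ip, Pi.sub_apply, inner_sub_left]
  exact integral_sub (integrable_inner_of_memLp hf hg) (integrable_inner_of_memLp hf' hg)

theorem ip_smul_left (c : ℝ) (f g : E3 → F) : ip Ω (c • f) g = c * ip Ω f g := by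
  simp only [ip, Pi.smul_apply, real_inner_smul_left]
  exact integral_const_mul _ _

theorem ip_add_right {f g g' : E3 → F} (hf : MemLp f 2 (volume.restrict Ω))
    (hg : MemLp g 2 (volume.restrict Ω)) (hg' : MemLp g' 2 (volume.restrict Ω)) :
    ip Ω f (g + g') = ip Ω f g + ip Ω f g' := by
  rw [ip_comm, ip_add_left hg hg' hf, ip_comm g, ip_comm g']

theorem ip_smul_right (c : ℝ) (f g : E3 → F) : ip Ω f (c • g) = c * ip Ω f g := by
  rw [ip_comm, ip_smul_left, ip_comm]

/-- Young's inequality for the `L²` inner product. -/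
theorem ip_le_young {f g : E3 → F} (hf : MemLp f 2 (volume.restrict Ω))
    (hg : MemLp g 2 (volume.restrict Ω)) {ε : ℝ} (hε : 0 < ε) :
    ip Ω f g ≤ ε / 2 * normSq Ω f + 1 / (2 * ε) * normSq Ω g := by
  simp only [ip, normSq, ← integral_const_mul]
  rw [← integral_add ((integrable_normSq hf).const_mul _) ((integrable_normSq hg).const_mul _)]
  refine integral_mono (integrable_inner_of_memLp hf hg)
    (((integrable_normSq hf).const_mul _).add ((integrable_normSq hg).const_mul _)) fun x => ?_
  refine (real_inner_le_norm _ _).trans ?_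
  have h : 0 ≤ (ε * ‖f x‖ - ‖g x‖) ^ 2 / (2 * ε) := by positivity
  have e : (ε * ‖f x‖ - ‖g x‖) ^ 2 / (2 * ε) =
      ε / 2 * ‖f x‖ ^ 2 + 1 / (2 * ε) * ‖g x‖ ^ 2 - ‖f x‖ * ‖g x‖ := by
    field_simp
    ring
  linarith

/-- The polarization step behind the stability of the backward Euler method. -/
theorem normSq_sub_normSq_le {f g : E3 → F} (hf : MemLp f 2 (volume.restrict Ω))
    (hg : MemLp g 2 (volume.restrict Ω)) :
    (normSq Ω f - normSq Ω g) / 2 ≤ ip Ω (f - g) f := by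
  rw [ip_sub_left hf hg hf, ip_self, ip_comm]
  have := ip_le_young hf hg one_pos
  linarith

/-- The matrix of partial derivatives of a function with values in `F`, with the Frobenius inner
product; for vector fields this is `vgrad`, for scalar functions it represents the gradient. -/
noncomputable def partials (u : E3 → F) (x : E3) : PiLp 2 (fun _ : Fin 3 => F) :=
  WithLp.toLp 2 fun i => fderiv ℝ u x (EuclideanSpace.single i 1)

theorem vgrad_eq_partials (u : E3 → E3) : vgrad u = partials u := rfl

theorem inner_gradient_gradient (f g : E3 → ℝ) (x : E3) :
    inner ℝ (gradient f x) (gradient g x) = inner ℝ (partials f x) (partials g x) := by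
  have h : ∀ (k : E3 → ℝ) (i : Fin 3),
      gradient k x i = fderiv ℝ k x (EuclideanSpace.single i 1) := fun k i => by
    rw [← inner_gradient_left, EuclideanSpace.inner_single_right]
    simp
  simp only [PiLp.inner_apply, h, partials]

theorem ip_gradient_gradient (f g : E3 → ℝ) :
    ip Ω (gradient f) (gradient g) = ip Ω (partials f) (partials g) := by
  simp only [ip, inner_gradient_gradient]

theorem normSq_gradient (f : E3 → ℝ) : normSq Ω (gradient f) = normSq Ω (partials f) := by
  rw [← ip_self, ip_gradient_gradient, ip_self]

/-! ### First order operators as linear maps into `L²` -/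

/-- `A` is linear, up to null sets, from the bounded Lipschitz functions to `L²(Ω)`. The
operators of the scheme have this property only up to null sets, since the derivative of a sum is
the sum of the derivatives only where both exist. -/
structure IsL2Op (Ω : Set E3) (A : (E3 → F) → E3 → G) : Prop where
  memLp : ∀ u, LipBdd Ω u → MemLp (A u) 2 (volume.restrict Ω)
  add : ∀ u v, LipBdd Ω u → LipBdd Ω v → A (u + v) =ᵐ[volume.restrict Ω] A u + A v
  smul : ∀ (c : ℝ) u, LipBdd Ω u → A (c • u) =ᵐ[volume.restrict Ω] c • A u

namespace IsL2Op

theorem id (hΩ : IsConvexPolyhedralDomain Ω) : IsL2Op Ω (fun u : E3 → F => u) where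
  memLp u hu := by
    have := hΩ.isFiniteMeasure
    exact (hu.memLp_top hΩ).mono_exponent le_top
  add _ _ _ _ := Filter.EventuallyEq.rfl
  smul _ _ _ := Filter.EventuallyEq.rfl

theorem smul_left {A : (E3 → F) → E3 → G} (hA : IsL2Op Ω A) {a : E3 → ℝ}
    (ha : MemLp a ⊤ (volume.restrict Ω)) : IsL2Op Ω (fun u x => a x • A u x) where
  memLp u hu := (hA.memLp u hu).smul (r := 2) ha
  add u v hu hv := by
    filter_upwards [hA.add u v hu hv] with x hx
    simp [hx]
  smul c u hu := by
    filter_upwards [hA.smul c u hu] with x hx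
    simp only [hx, Pi.smul_apply]
    rw [smul_comm]

/-- The bilinear form `(u, v) ↦ (A u, B v)` on spaces of bounded Lipschitz functions. -/
noncomputable def form {F' : Type*} [NormedAddCommGroup F'] [InnerProductSpace ℝ F']
    {A : (E3 → F) → E3 → G} {B : (E3 → F') → E3 → G} (hA : IsL2Op Ω A) (hB : IsL2Op Ω B)
    {X : Submodule ℝ (E3 → F)} {Y : Submodule ℝ (E3 → F')} (hX : ∀ u ∈ X, LipBdd Ω u)
    (hY : ∀ v ∈ Y, LipBdd Ω v) : X →ₗ[ℝ] Y →ₗ[ℝ] ℝ :=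
  LinearMap.mk₂ ℝ (fun u v => ip Ω (A u.1) (B v.1))
    (fun u u' v => by
      have h := hX _ u.2
      have h' := hX _ u'.2
      have k := hY _ v.2
      rw [← ip_add_left (hA.memLp _ h) (hA.memLp _ h') (hB.memLp _ k)]
      exact ip_congr (hA.add _ _ h h') Filter.EventuallyEq.rfl)
    (fun c u v => by
      rw [smul_eq_mul, ← ip_smul_left]
      exact ip_congr (hA.smul c _ (hX _ u.2)) Filter.EventuallyEq.rfl)
    (fun u v v' => by
      have h := hX _ u.2
      have k := hY _ v.2
      have k' := hY _ v'.2
      rw [← ip_add_right (hA.memLp _ h) (hB.memLp _ k) (hB.memLp _ k')]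
      exact ip_congr Filter.EventuallyEq.rfl (hB.add _ _ k k'))
    (fun c u v => by
      rw [smul_eq_mul, ← ip_smul_right]
      exact ip_congr Filter.EventuallyEq.rfl (hB.smul c _ (hY _ v.2)))

/-- The linear functional `v ↦ (f, v)` on a space of bounded Lipschitz functions. -/
noncomputable def _root_.FEM.load {X : Submodule ℝ (E3 → F)} (hΩ : IsConvexPolyhedralDomain Ω)
    (hX : ∀ u ∈ X, LipBdd Ω u) {f : E3 → F} (hf : MemLp f 2 (volume.restrict Ω)) : X →ₗ[ℝ] ℝ where
  toFun v := ip Ω f v.1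
  map_add' v v' := ip_add_right hf ((IsL2Op.id hΩ).memLp _ (hX _ v.2))
    ((IsL2Op.id hΩ).memLp _ (hX _ v'.2))
  map_smul' c v := ip_smul_right c f v.1

variable [FiniteDimensional ℝ F]

theorem fderiv_apply (hΩ : IsConvexPolyhedralDomain Ω) {b : E3 → E3}
    (hb : MemLp b 2 (volume.restrict Ω)) :
    IsL2Op Ω (fun (u : E3 → F) x => fderiv ℝ u x (b x)) where
  memLp u hu := (ContinuousLinearMap.id ℝ (E3 →L[ℝ] F)).memLp_of_bilin 2 (hu.fderiv_memLp_top hΩ) hb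
  add u v hu hv := by
    filter_upwards [hu.ae_differentiableAt hΩ, hv.ae_differentiableAt hΩ] with x h1 h2
    simp [fderiv_add h1 h2]
  smul c u hu := by
    filter_upwards [hu.ae_differentiableAt hΩ] with x h1
    simp [fderiv_const_smul h1]

theorem clm_fderiv (hΩ : IsConvexPolyhedralDomain Ω) (L : (E3 →L[ℝ] F) →L[ℝ] G) :
    IsL2Op Ω (fun (u : E3 → F) x => L (fderiv ℝ u x)) where
  memLp u hu := by
    have := hΩ.isFiniteMeasure
    exact L.comp_memLp' ((hu.fderiv_memLp_top hΩ).mono_exponent le_top)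
  add u v hu hv := by
    filter_upwards [hu.ae_differentiableAt hΩ, hv.ae_differentiableAt hΩ] with x h1 h2
    simp [fderiv_add h1 h2]
  smul c u hu := by
    filter_upwards [hu.ae_differentiableAt hΩ] with x h1
    simp [fderiv_const_smul h1]

theorem partials (hΩ : IsConvexPolyhedralDomain Ω) :
    IsL2Op Ω (fun u : E3 → F => partials u) :=
  clm_fderiv hΩ ((PiLp.continuousLinearEquiv 2 ℝ (fun _ : Fin 3 => F)).symm.toContinuousLinearMap ∘L
    ContinuousLinearMap.pi fun i => ContinuousLinearMap.apply ℝ F (EuclideanSpace.single i 1))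

/-- The divergence of a bounded Lipschitz field, as a bounded function. -/
theorem _root_.FEM.LipBdd.divg_memLp_top (hΩ : IsConvexPolyhedralDomain Ω) {b : E3 → E3}
    (hb : LipBdd Ω b) : MemLp (divg b) ⊤ (volume.restrict Ω) := by
  have := ContinuousLinearMap.comp_memLp' (∑ i : Fin 3,
    (EuclideanSpace.proj (𝕜 := ℝ) i : E3 →L[ℝ] ℝ) ∘L
      ContinuousLinearMap.apply ℝ E3 (EuclideanSpace.single i 1)) (hb.fderiv_memLp_top hΩ)
  convert this using 1
  funext x
  simp [FEM.divg]

theorem divg (hΩ : IsConvexPolyhedralDomain Ω) : IsL2Op Ω divg := by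
  convert clm_fderiv (F := E3) hΩ (∑ i : Fin 3, (EuclideanSpace.proj (𝕜 := ℝ) i : E3 →L[ℝ] ℝ) ∘L
      ContinuousLinearMap.apply ℝ E3 (EuclideanSpace.single i 1)) using 3 with u x
  simp [FEM.divg]

end IsL2Op

/-! ### Integration by parts, skew symmetry and the Poincaré inequality -/

theorem LipBdd.integrable_fderiv_apply {f : E3 → ℝ} (hf : LipBdd Ω f)
    (hΩ : IsConvexPolyhedralDomain Ω) (v : E3) :
    Integrable (fun x => fderiv ℝ f x v) (volume.restrict Ω) := by
  have := hΩ.isFiniteMeasure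
  exact ((ContinuousLinearMap.apply ℝ ℝ v).comp_memLp'
    (hf.fderiv_memLp_top hΩ)).integrable le_top

/-- Green's formula for a field `b` that vanishes on the boundary. -/
theorem integral_divg_mul_add {b : E3 → E3} {h : E3 → ℝ} (hΩ : IsConvexPolyhedralDomain Ω)
    (hb : LipBdd Ω b) (hb0 : ∀ x ∉ Ω, b x = 0) (hh : LipBdd Ω h) :
    ∫ x in Ω, (divg b x * h x + fderiv ℝ h x (b x)) = 0 := by
  have hbi : ∀ i : Fin 3, LipBdd Ω (fun x => b x i) := fun i =>
    hb.clm (EuclideanSpace.proj (𝕜 := ℝ) i : E3 →L[ℝ] ℝ)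
  have hG : ∀ i : Fin 3, LipBdd Ω (fun x => b x i * h x) := fun i => (hbi i).mul hh
  have hint : ∀ i : Fin 3, Integrable
      (fun x => fderiv ℝ (fun y => b y i * h y) x (EuclideanSpace.single i 1))
      (volume.restrict Ω) := fun i => by
    exact (hG i).integrable_fderiv_apply hΩ _
  have h0 : ∑ i : Fin 3, ∫ x in Ω,
      fderiv ℝ (fun y => b y i * h y) x (EuclideanSpace.single i 1) = 0 :=
    Finset.sum_eq_zero fun i _ =>
      integral_fderiv_eq_zero (hG i) hΩ (fun x hx => by simp [hb0 x hx]) _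
  rw [← integral_finsetSum _ fun i _ => hint i] at h0
  rw [← h0]
  refine integral_congr_ae ?_
  filter_upwards [hb.ae_differentiableAt hΩ, hh.ae_differentiableAt hΩ] with x h1 h2
  rw [fderiv_apply_eq_sum x (b x), divg, Finset.sum_mul, ← Finset.sum_add_distrib]
  refine Finset.sum_congr rfl fun i _ => ?_
  have h3 : HasFDerivAt (fun y => b y i)
      ((EuclideanSpace.proj (𝕜 := ℝ) i : E3 →L[ℝ] ℝ) ∘L fderiv ℝ b x) x :=
    (EuclideanSpace.proj (𝕜 := ℝ) i : E3 →L[ℝ] ℝ).hasFDerivAt.comp x h1.hasFDerivAt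
  rw [(h3.fun_mul h2.hasFDerivAt).fderiv]
  simp
  ring

theorem fderiv_norm_sq_apply {u : E3 → F} {x : E3} (h : DifferentiableAt ℝ u x) (v : E3) :
    fderiv ℝ (fun y => inner ℝ (u y) (u y)) x v = 2 * inner ℝ (fderiv ℝ u x v) (u x) := by
  rw [fderiv_inner_apply ℝ h h, real_inner_comm]
  ring

variable [FiniteDimensional ℝ F]

/-- The convection term and its stabilization add up to a skew-symmetric form. -/
theorem convection_self_eq_zero {b : E3 → E3} {u : E3 → F} (hΩ : IsConvexPolyhedralDomain Ω)
    (hb : LipBdd Ω b) (hb0 : ∀ x ∉ Ω, b x = 0) (hu : LipBdd Ω u) :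
    ip Ω (fun x => fderiv ℝ u x (b x)) u + 1 / 2 * ip Ω (fun x => divg b x • u x) u = 0 := by
  have h := integral_divg_mul_add hΩ hb hb0 (hu.inner hu)
  have hid : IsL2Op Ω (fun u : E3 → F => u) := IsL2Op.id hΩ
  have i1 := integrable_inner_of_memLp
    ((IsL2Op.fderiv_apply hΩ ((IsL2Op.id hΩ).memLp b hb)).memLp u hu) (hid.memLp u hu)
  have i2 := integrable_inner_of_memLp
    ((hid.smul_left (hb.divg_memLp_top hΩ)).memLp u hu) (hid.memLp u hu)
  rw [ip, ip, ← integral_const_mul, ← integral_add i1 (i2.const_mul _)]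
  rw [← mul_zero (1 / 2 : ℝ), ← h, ← integral_const_mul]
  refine integral_congr_ae ?_
  filter_upwards [hu.ae_differentiableAt hΩ] with x hx
  rw [fderiv_norm_sq_apply hx, real_inner_smul_left]
  ring

/-- The Poincaré inequality, from the divergence theorem applied to `x₀ ‖u‖²`. The constant depends
only on a ball containing the domain. -/
theorem poincare (hΩ : IsConvexPolyhedralDomain Ω) {R : ℝ} (hR : 0 < R)
    (hR' : ∀ x ∈ closure Ω, ‖x‖ ≤ R) {u : E3 → F} (hu : LipBdd Ω u) (hu0 : ∀ x ∉ Ω, u x = 0) :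
    normSq Ω u ≤ 4 * R ^ 2 * normSq Ω (partials u) := by
  have hx0 := LipBdd.identity hΩ
  have hc : LipBdd Ω (fun x : E3 => x 0) := hx0.clm (EuclideanSpace.proj (𝕜 := ℝ) 0 : E3 →L[ℝ] ℝ)
  have hG := hc.mul (hu.inner hu)
  have h := integral_fderiv_eq_zero hG hΩ (fun x hx => by simp [hu0 x hx])
    (EuclideanSpace.single 0 1)
  have hint := hG.integrable_fderiv_apply hΩ (EuclideanSpace.single 0 1)
  have iu := integrable_normSq ((IsL2Op.id hΩ).memLp u hu)
  have ip' := integrable_normSq ((IsL2Op.partials hΩ).memLp u hu)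
  -- The integrand of `h` is `‖u‖² + 2 x₀ ⟨∂₀ u, u⟩`; Young's inequality bounds it from below.
  have key : ∫ x in Ω, (1 / 2 * ‖u x‖ ^ 2 - 2 * R ^ 2 * ‖partials u x‖ ^ 2) ≤ 0 := by
    rw [← h]
    refine integral_mono_ae ((iu.const_mul _).sub (ip'.const_mul _)) hint ?_
    filter_upwards [hu.ae_differentiableAt hΩ, ae_restrict_mem hΩ.isOpen.measurableSet]
      with x hx hxΩ
    have h3 : HasFDerivAt (fun y : E3 => y 0) (EuclideanSpace.proj (𝕜 := ℝ) 0 : E3 →L[ℝ] ℝ) x :=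
      (EuclideanSpace.proj (𝕜 := ℝ) 0 : E3 →L[ℝ] ℝ).hasFDerivAt
    have e : fderiv ℝ (fun x : E3 => x 0 * inner ℝ (u x) (u x)) x (EuclideanSpace.single 0 1) =
        ‖u x‖ ^ 2 + 2 * x 0 * inner ℝ (partials u x 0) (u x) := by
      have h4 := (hx.inner ℝ hx).hasFDerivAt
      rw [(h3.fun_mul h4).fderiv, add_apply, smul_apply, smul_apply, fderiv_norm_sq_apply hx]
      simp [partials]
      ring
    have hp : ‖partials u x 0‖ ≤ ‖partials u x‖ := PiLp.norm_apply_le _ _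
    have hxR : |x 0| ≤ R := (PiLp.norm_apply_le x 0).trans (hR' x (subset_closure hxΩ))
    have hin : |x 0 * inner ℝ (partials u x 0) (u x)| ≤ R * (‖partials u x‖ * ‖u x‖) := by
      rw [abs_mul]
      gcongr
      exact (abs_real_inner_le_norm _ _).trans (by gcongr)
    simp only [e]
    nlinarith [neg_abs_le (x 0 * inner ℝ (partials u x 0) (u x)),
      sq_nonneg (‖u x‖ - 2 * R * ‖partials u x‖)]
  rw [integral_sub (iu.const_mul _) (ip'.const_mul _), integral_const_mul, integral_const_mul]
    at key
  simp only [normSq]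
  linarith

end Integrals

/-! ### Continuous piecewise smooth functions are Lipschitz -/

/-- A continuous function on a convex set that is `L`-Lipschitz on each set of a finite closed
cover is `L`-Lipschitz: along a segment, every point has a right neighbourhood that only meets the
sets of the cover containing the point. -/
theorem norm_sub_le_of_finite_closed_cover {E F ι : Type*} [NormedAddCommGroup E] [NormedSpace ℝ E]
    [NormedAddCommGroup F] [Finite ι] {s : Set E} (hs : Convex ℝ s) {f : E → F}
    (hf : ContinuousOn f s) {K : ι → Set E} (hK : ∀ i, IsClosed (K i)) (hc : s ⊆ ⋃ i, K i) {L : ℝ}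
    (hL : ∀ i, ∀ x ∈ K i ∩ s, ∀ y ∈ K i ∩ s, ‖f x - f y‖ ≤ L * ‖x - y‖) :
    ∀ x ∈ s, ∀ y ∈ s, ‖f x - f y‖ ≤ L * ‖x - y‖ := by
  intro x hx y hy
  let γ : ℝ → E := AffineMap.lineMap x y
  have hγc : Continuous γ := AffineMap.lineMap_continuous
  have hγs : ∀ t ∈ Set.Icc (0 : ℝ) 1, γ t ∈ s := fun t ht => hs.lineMap_mem hx hy ht
  have hγd : ∀ t z, ‖γ z - γ t‖ = |z - t| * ‖x - y‖ := fun t z => by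
    rw [← dist_eq_norm, dist_lineMap_lineMap, Real.dist_eq, dist_eq_norm]
  have h := image_le_of_liminf_slope_right_le_deriv_boundary (f := fun t => ‖f (γ t) - f x‖)
    (a := 0) (b := 1) (B := fun t => L * ‖x - y‖ * t) (B' := fun _ => L * ‖x - y‖)
    ((hf.comp hγc.continuousOn hγs).sub continuousOn_const).norm (by simp [γ])
    (by fun_prop)
    (fun t _ => by simpa using ((hasDerivAt_id t).const_mul (L * ‖x - y‖)).hasDerivWithinAt)
    (fun t ht r hr => ?_) (Set.right_mem_Icc.2 zero_le_one)
  · simpa [γ, norm_sub_rev] using h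
  · apply Filter.Eventually.frequently
    have hev : ∀ i, ∀ᶠ z in nhdsWithin t (Set.Ioi t), γ z ∈ K i → γ t ∈ K i := by
      intro i
      by_cases hi : γ t ∈ K i
      · exact Filter.Eventually.of_forall fun _ _ => hi
      · have : ∀ᶠ z in nhds t, γ z ∈ (K i)ᶜ :=
          hγc.continuousAt.eventually_mem ((hK i).isOpen_compl.mem_nhds hi)
        filter_upwards [nhdsWithin_le_nhds this] with z hz h using absurd h hz
    filter_upwards [Filter.eventually_all.2 hev, Ioo_mem_nhdsGT ht.2] with z hz hz1
    have hzs := hγs z ⟨ht.1.trans hz1.1.le, hz1.2.le⟩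
    have hts := hγs t ⟨ht.1, ht.2.le⟩
    obtain ⟨i, hi⟩ := Set.mem_iUnion.1 (hc hzs)
    have hle := hL i _ ⟨hi, hzs⟩ _ ⟨hz i hi, hts⟩
    rw [hγd, abs_of_pos (sub_pos.2 hz1.1)] at hle
    refine lt_of_le_of_lt ?_ hr
    rw [slope_def_field, div_le_iff₀ (sub_pos.2 hz1.1)]
    have h3 := norm_sub_norm_le (f (γ z) - f x) (f (γ t) - f x)
    rw [sub_sub_sub_cancel_right] at h3
    linarith

section

variable {Ω : Set E3} {F : Type*} [NormedAddCommGroup F] [NormedSpace ℝ F]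

theorem LipBdd.affine (hΩ : IsConvexPolyhedralDomain Ω) (a : E3 →ᵃ[ℝ] F) : LipBdd Ω a := by
  have h := ((LipBdd.identity hΩ).clm (LinearMap.toContinuousLinearMap a.linear)).add (LipBdd.const (a 0))
  have e : (fun x => LinearMap.toContinuousLinearMap a.linear x + a 0) = a := by
    funext x
    simpa using (congrFun a.decomp x).symm
  rwa [e] at h

/-- The `L²` norm is definite on continuous functions on the closed domain. -/
theorem LipBdd.eq_zero_of_normSq {F : Type*} [NormedAddCommGroup F] [InnerProductSpace ℝ F]
    (hΩ : IsConvexPolyhedralDomain Ω) {f : E3 → F} (hf : LipBdd Ω f) (h : normSq Ω f = 0) :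
    ∀ x ∈ closure Ω, f x = 0 := by
  have h1 := (integral_eq_zero_iff_of_nonneg (fun x => by positivity)
    (integrable_normSq ((IsL2Op.id hΩ).memLp f hf))).1 h
  have h2 : f =ᵐ[volume.restrict Ω] fun _ => 0 := by
    filter_upwards [h1] with x hx
    simpa using hx
  have h3 := Measure.eqOn_open_of_ae_eq h2 hΩ.isOpen (hf.continuousOn.mono subset_closure)
    continuousOn_const
  exact h3.of_subset_closure hf.continuousOn continuousOn_const subset_closure le_rfl

end

namespace TetMesh

variable {Ω : Set E3} (T : TetMesh Ω)

variable {T} in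
theorem Tet.carrier_subset (K : T.Tet) : K.carrier ⊆ closure Ω := by
  rw [← T.space_eq]
  exact T.complex.convexHull_subset_space K.2.1

variable {T} in
theorem Tet.isClosed_carrier (K : T.Tet) : IsClosed K.carrier :=
  (K.1.finite_toSet.isCompact_convexHull (𝕜 := ℝ)).isClosed

variable {T} in
theorem Tet.range_basis (K : T.Tet) : Set.range K.basis = (K.1 : Set E3) :=
  Subtype.range_coe_subtype

variable {T} in
theorem Tet.carrier_eq (K : T.Tet) : K.carrier = {x | ∀ i, 0 ≤ K.basis.coord i x} := by
  rw [← K.basis.convexHull_eq_nonneg_coord, K.range_basis, Tet.carrier]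

variable {T} in
theorem Tet.interior_carrier (K : T.Tet) :
    interior K.carrier = {x | ∀ i, 0 < K.basis.coord i x} := by
  rw [← K.basis.interior_convexHull, K.range_basis, Tet.carrier]

theorem lipBdd_of_piecewise {F : Type*} [NormedAddCommGroup F] (hΩ : IsConvexPolyhedralDomain Ω)
    {f : E3 → F} (hf : ContinuousOn f (closure Ω))
    (h : ∀ K : T.Tet, ∃ k : E3 → F, LipBdd Ω k ∧ ∀ x ∈ K.carrier, f x = k x) : LipBdd Ω f := by
  classical
  have := Fintype.ofFinite T.Tet
  choose k hk hfk using h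
  choose C hC h1 h2 using hk
  have hCle : ∀ K, C K ≤ ∑ K, C K := fun K =>
    Finset.single_le_sum (fun K _ => hC K) (Finset.mem_univ K)
  refine ⟨∑ K, C K, Finset.sum_nonneg fun K _ => hC K, ?_, fun x hx => ?_⟩
  · refine norm_sub_le_of_finite_closed_cover hΩ.convex.closure hf (K := fun K : T.Tet => K.carrier)
      (fun K => K.isClosed_carrier) (fun x hx => Set.mem_iUnion.2 (T.exists_mem_carrier hx)) ?_
    rintro K x ⟨hxK, hx⟩ y ⟨hyK, hy⟩
    rw [hfk K x hxK, hfk K y hyK]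
    exact (h1 K x hx y hy).trans (by gcongr; exact hCle K)
  · obtain ⟨K, hK⟩ := T.exists_mem_carrier hx
    rw [hfk K x hK]
    exact (h2 K x hx).trans (hCle K)

variable {T} in
theorem Tet.lipBdd_bubble (hΩ : IsConvexPolyhedralDomain Ω) (K : T.Tet) :
    LipBdd Ω K.bubble := by
  have h : ∀ s : Finset K.1, LipBdd Ω (fun x => ∏ v ∈ s, K.basis.coord v x) := by
    classical
    intro s
    induction s using Finset.induction_on with
    | empty => simpa using LipBdd.const (1 : ℝ)
    | insert a s ha ih =>
      simp only [Finset.prod_insert ha]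
      exact (LipBdd.affine hΩ (K.basis.coord a)).mul ih
  exact h Finset.univ

theorem lipBdd_W (hΩ : IsConvexPolyhedralDomain Ω) : ∀ f ∈ T.W, LipBdd Ω f := fun _ hf =>
  T.lipBdd_of_piecewise hΩ hf.1 fun K => by
    obtain ⟨a, ha⟩ := hf.2.2 K
    exact ⟨a, LipBdd.affine hΩ a, ha⟩

theorem lipBdd_F (hΩ : IsConvexPolyhedralDomain Ω) : ∀ f ∈ T.F, LipBdd Ω f :=
  fun f hf => T.lipBdd_W hΩ f hf.1

theorem lipBdd_M (hΩ : IsConvexPolyhedralDomain Ω) : ∀ f ∈ T.M, LipBdd Ω f :=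
  fun f hf => T.lipBdd_W hΩ f hf.1

theorem lipBdd_V (hΩ : IsConvexPolyhedralDomain Ω) : ∀ f ∈ T.V, LipBdd Ω f := fun _ hf =>
  T.lipBdd_of_piecewise hΩ hf.1 fun K => by
    obtain ⟨a, c, ha⟩ := hf.2.2.2 K
    exact ⟨_, (LipBdd.affine hΩ a).add ((K.lipBdd_bubble hΩ).smul (LipBdd.const c)), ha⟩

theorem eq_zero_of_notMem {E : Type*} [Zero E] (hΩ : IsConvexPolyhedralDomain Ω) {f : E3 → E}
    (h0 : ∀ x ∉ closure Ω, f x = 0) (h1 : ∀ x ∈ frontier Ω, f x = 0) : ∀ x ∉ Ω, f x = 0 := by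
  intro x hx
  by_cases hc : x ∈ closure Ω
  · exact h1 x (by rw [hΩ.isOpen.frontier_eq]; exact ⟨hc, hx⟩)
  · exact h0 x hc

theorem F_eq_zero (hΩ : IsConvexPolyhedralDomain Ω) {f : E3 → ℝ} (hf : f ∈ T.F) :
    ∀ x ∉ Ω, f x = 0 := eq_zero_of_notMem hΩ hf.1.2.1 hf.2

theorem V_eq_zero (hΩ : IsConvexPolyhedralDomain Ω) {f : E3 → E3} (hf : f ∈ T.V) :
    ∀ x ∉ Ω, f x = 0 := eq_zero_of_notMem hΩ hf.2.1 hf.2.2.1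

/-! ### Finite dimension -/

/-- Functions vanishing off the closed domain that are on each tetrahedron the sum of an affine
function and a multiple of the bubble function; continuity is not required. -/
def brokenSpace (F : Type*) [NormedAddCommGroup F] [NormedSpace ℝ F] :
    Submodule ℝ ((E3 → F) × (T.Tet → (E3 →ᵃ[ℝ] F) × F)) where
  carrier := {z | (∀ x ∉ closure Ω, z.1 x = 0) ∧
    ∀ K : T.Tet, ∀ x ∈ K.carrier, z.1 x = (z.2 K).1 x + K.bubble x • (z.2 K).2}
  add_mem' := by
    rintro z z' ⟨h0, h⟩ ⟨h0', h'⟩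
    refine ⟨fun x hx => by simp [h0 x hx, h0' x hx], fun K x hx => ?_⟩
    simp only [Prod.fst_add, Prod.snd_add, Pi.add_apply, h K x hx, h' K x hx, AffineMap.coe_add,
      smul_add]
    abel
  zero_mem' := ⟨fun _ _ => rfl, fun _ _ _ => by simp⟩
  smul_mem' := by
    rintro r z ⟨h0, h⟩
    refine ⟨fun x hx => by simp [h0 x hx], fun K x hx => ?_⟩
    simp [h K x hx, smul_comm r]

instance (F : Type*) [NormedAddCommGroup F] [NormedSpace ℝ F] [FiniteDimensional ℝ F] :
    FiniteDimensional ℝ (T.brokenSpace F) := by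
  refine FiniteDimensional.of_injective
    ((LinearMap.snd ℝ (E3 → F) (T.Tet → (E3 →ᵃ[ℝ] F) × F)).comp (T.brokenSpace F).subtype) ?_
  rw [← LinearMap.ker_eq_bot, LinearMap.ker_eq_bot']
  rintro ⟨⟨f, c⟩, h0, h⟩ hc
  have hc : c = 0 := hc
  subst hc
  have : f = 0 := by
    funext x
    by_cases hx : x ∈ closure Ω
    · obtain ⟨K, hK⟩ := T.exists_mem_carrier hx
      simpa using h K x hK
    · exact h0 x hx
  subst this
  rfl

instance : FiniteDimensional ℝ T.W := by
  refine Submodule.finiteDimensional_of_le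
    (S₂ := (T.brokenSpace ℝ).map (LinearMap.fst ℝ _ _)) fun f hf => ?_
  choose a ha using hf.2.2
  exact ⟨(f, fun K => (a K, 0)), ⟨hf.2.1, fun K x hx => by simpa using ha K x hx⟩, rfl⟩

instance : FiniteDimensional ℝ T.F :=
  Submodule.finiteDimensional_of_le (S₂ := T.W) fun _ hf => hf.1

instance : FiniteDimensional ℝ T.M :=
  Submodule.finiteDimensional_of_le (S₂ := T.W) fun _ hf => hf.1

instance : FiniteDimensional ℝ T.V := by
  refine Submodule.finiteDimensional_of_le
    (S₂ := (T.brokenSpace E3).map (LinearMap.fst ℝ _ _)) fun f hf => ?_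
  choose a c ha using hf.2.2.2
  exact ⟨(f, fun K => (a K, c K)), ⟨hf.2.1, ha⟩, rfl⟩

/-! ### Bubble test fields and the uniqueness of the pressure -/

section Bubble

variable {T}

/-- The bubble function of `K`, extended by zero outside `K`. -/
noncomputable def Tet.posBubble (K : T.Tet) (x : E3) : ℝ :=
  ∏ v : K.1, max (K.basis.coord v x) 0

theorem Tet.posBubble_nonneg (K : T.Tet) (x : E3) : 0 ≤ K.posBubble x :=
  Finset.prod_nonneg fun _ _ => le_max_right _ _

theorem Tet.posBubble_eq_bubble (K : T.Tet) {x : E3} (hx : x ∈ K.carrier) :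
    K.posBubble x = K.bubble x := by
  rw [K.carrier_eq] at hx
  exact Finset.prod_congr rfl fun v _ => max_eq_left (hx v)

theorem Tet.mem_interior_of_posBubble_ne_zero (K : T.Tet) {x : E3} (h : K.posBubble x ≠ 0) :
    x ∈ interior K.carrier := by
  rw [K.interior_carrier]
  intro v
  by_contra! hv
  exact h (Finset.prod_eq_zero (Finset.mem_univ v) (max_eq_right hv))

theorem Tet.continuous_posBubble (K : T.Tet) : Continuous K.posBubble :=
  continuous_finsetProd _ fun v _ =>
    (K.basis.coord v).continuous_of_finiteDimensional.max continuous_const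

theorem Tet.interior_subset (hΩ : IsConvexPolyhedralDomain Ω) (K : T.Tet) :
    interior K.carrier ⊆ Ω :=
  (interior_mono K.carrier_subset).trans hΩ.interior_closure.subset

theorem Tet.posBubble_eq_zero (hΩ : IsConvexPolyhedralDomain Ω) (K : T.Tet) {x : E3}
    (hx : x ∉ Ω) : K.posBubble x = 0 := by
  by_contra h
  exact hx (K.interior_subset hΩ (K.mem_interior_of_posBubble_ne_zero h))

theorem Tet.integral_posBubble_pos (hΩ : IsConvexPolyhedralDomain Ω) (K : T.Tet) :
    0 < ∫ x in Ω, K.posBubble x := by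
  rw [setIntegral_eq_integral_of_forall_compl_eq_zero fun x hx => K.posBubble_eq_zero hΩ hx]
  have hne : (interior K.carrier).Nonempty := by
    have h := K.basis.centroid_mem_interior_convexHull
    rw [K.range_basis] at h
    exact ⟨_, h⟩
  obtain ⟨x, hx⟩ := hne
  rw [K.interior_carrier] at hx
  exact K.continuous_posBubble.integral_pos_of_hasCompactSupport_nonneg_nonzero
    (HasCompactSupport.intro hΩ.isCompact_closure
      fun y hy => K.posBubble_eq_zero hΩ fun h => hy (subset_closure h))
    K.posBubble_nonneg (x := x)
    (Finset.prod_pos fun v _ => lt_max_of_lt_left (hx v)).ne'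

/-- Conformity: the interior of a tetrahedron does not meet the other tetrahedra. -/
theorem Tet.posBubble_eq_zero_of_ne {K K' : T.Tet} (h : K' ≠ K) {x : E3} (hx : x ∈ K'.carrier) :
    K.posBubble x = 0 := by
  by_contra hne
  have hxi := K.mem_interior_of_posBubble_ne_zero hne
  have hxK := _root_.interior_subset hxi
  rw [K.interior_carrier] at hxi
  obtain ⟨w, hwK, hwK'⟩ : ∃ w ∈ K.1, w ∉ K'.1 := by
    by_contra! hc
    exact h (Subtype.ext (Finset.eq_of_subset_of_card_le hc (by rw [K.2.2, K'.2.2])).symm)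
  have hsub : (K.1 : Set E3) ∩ K'.1 ⊆ {y | K.basis.coord ⟨w, hwK⟩ y = 0} := by
    rintro y ⟨hy, hy'⟩
    have hyK : y ∈ K.1 := Finset.mem_coe.1 hy
    have hyw : (⟨w, hwK⟩ : K.1) ≠ ⟨y, hyK⟩ := fun e => hwK' (by
      rw [show w = y from congrArg Subtype.val e]; exact Finset.mem_coe.1 hy')
    have hb : K.basis ⟨y, hyK⟩ = y := rfl
    have h0 := K.basis.coord_apply_ne hyw
    rw [hb] at h0
    exact h0
  have hconv : Convex ℝ {y | K.basis.coord ⟨w, hwK⟩ y = 0} :=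
    (convex_singleton (0 : ℝ)).affine_preimage (K.basis.coord ⟨w, hwK⟩)
  have hmem := convexHull_min hsub hconv (T.complex.inter_subset_convexHull K.2.1 K'.2.1 ⟨hxK, hx⟩)
  exact (hxi ⟨w, hwK⟩).ne' hmem

theorem Tet.posBubble_smul_mem (hΩ : IsConvexPolyhedralDomain Ω) (K : T.Tet) (e : E3) :
    (fun x => K.posBubble x • e) ∈ T.V := by
  classical
  refine ⟨(K.continuous_posBubble.smul continuous_const).continuousOn, fun x hx => ?_,
    fun x hx => ?_, fun K' => ?_⟩
  · simp [K.posBubble_eq_zero hΩ fun h => hx (subset_closure h)]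
  · rw [hΩ.isOpen.frontier_eq] at hx
    simp [K.posBubble_eq_zero hΩ hx.2]
  · by_cases h : K' = K
    · subst h
      exact ⟨0, e, fun x hx => by simp [K'.posBubble_eq_bubble hx]⟩
    · exact ⟨0, 0, fun x hx => by simp [posBubble_eq_zero_of_ne h hx]⟩

end Bubble

/-- The divergence of the mini element controls the pressure: testing with bubbles shows that the
gradient of `p` vanishes on each tetrahedron. -/
theorem pressure_eq_zero (hΩ : IsConvexPolyhedralDomain Ω) (p : T.M)
    (h : ∀ v : T.V, ip Ω (divg v.1) p.1 = 0) : p = 0 := by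
  have hp := T.lipBdd_M hΩ p.1 p.2
  have hconst : ∀ x ∈ closure Ω, ∀ y ∈ closure Ω, ‖p.1 x - p.1 y‖ ≤ 0 * ‖x - y‖ := by
    refine norm_sub_le_of_finite_closed_cover hΩ.convex.closure p.2.1.1
      (K := fun K : T.Tet => K.carrier) (fun K => K.isClosed_carrier)
      (fun x hx => Set.mem_iUnion.2 (T.exists_mem_carrier hx)) ?_
    intro K x hx y hy
    obtain ⟨a, ha⟩ := p.2.1.2.2 K
    -- Green's formula for the bubble field in direction `e` gives `(∫ posBubble) * ∂ₑ p = 0`.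
    have hlin : ∀ e, a.linear e = 0 := by
      intro e
      have hv := K.posBubble_smul_mem hΩ e
      have h1 := integral_divg_mul_add hΩ (T.lipBdd_V hΩ _ hv) (T.V_eq_zero hΩ hv) hp
      have i1 : Integrable (fun x => divg (fun x => K.posBubble x • e) x * p.1 x)
          (volume.restrict Ω) := by
        simpa [mul_comm] using integrable_inner_of_memLp
          ((IsL2Op.divg hΩ).memLp _ (T.lipBdd_V hΩ _ hv)) ((IsL2Op.id hΩ).memLp _ hp)
      have e2 : ∀ x, fderiv ℝ p.1 x (K.posBubble x • e) = K.posBubble x * a.linear e := by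
        intro x
        by_cases h0 : K.posBubble x = 0
        · simp [h0]
        · have hxi := K.mem_interior_of_posBubble_ne_zero h0
          have he : p.1 =ᶠ[nhds x] a := by
            filter_upwards [isOpen_interior.mem_nhds hxi] with y hy
            exact ha y (interior_subset hy)
          have hd : HasFDerivAt a (LinearMap.toContinuousLinearMap a.linear) x := by
            rw [show (a : E3 → ℝ) = fun x => LinearMap.toContinuousLinearMap a.linear x + a 0 from
              funext fun x => by simpa using congrFun a.decomp x]
            exact (LinearMap.toContinuousLinearMap a.linear).hasFDerivAt.add_const _
          rw [he.fderiv_eq, hd.fderiv]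
          simp
      simp only [e2] at h1
      have i2 : Integrable (fun x => K.posBubble x * a.linear e) (volume.restrict Ω) :=
        (T.integrable_of_continuousOn K.continuous_posBubble.continuousOn).mul_const _
      rw [integral_add i1 i2, integral_mul_const] at h1
      have h3 : ∫ x in Ω, divg (fun x => K.posBubble x • e) x * p.1 x = 0 := by
        simpa [ip, mul_comm] using h ⟨_, hv⟩
      rw [h3, zero_add] at h1
      exact (mul_eq_zero.1 h1).resolve_left (K.integral_posBubble_pos hΩ).ne'
    rw [ha x hx.1, ha y hy.1, ← vsub_eq_sub, ← a.linearMap_vsub, hlin]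
    simp
  obtain ⟨x₀, hx₀⟩ := hΩ.1
  have hc : ∀ x ∈ closure Ω, p.1 x = p.1 x₀ := fun x hx => by
    have := hconst x hx x₀ (subset_closure hx₀)
    rw [zero_mul, norm_le_zero_iff, sub_eq_zero] at this
    exact this
  have hint := p.2.2
  rw [setIntegral_congr_fun hΩ.isOpen.measurableSet fun x hx => hc x (subset_closure hx)] at hint
  have := hΩ.isFiniteMeasure
  have hvol : volume.real Ω ≠ 0 :=
    (ENNReal.toReal_pos hΩ.volume_pos.ne' (by
      rw [← Measure.restrict_apply_univ]; exact measure_ne_top _ _)).ne'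
  rw [setIntegral_const, smul_eq_mul] at hint
  have h0 := (mul_eq_zero.1 hint).resolve_left hvol
  ext x
  by_cases hx : x ∈ closure Ω
  · exact (hc x hx).trans h0
  · exact p.2.1.2.1 x hx

end TetMesh

/-! ### The linear problems of one step -/

/-- A square linear system with trivial kernel is uniquely solvable. -/
theorem existsUnique_of_ker_eq_zero {X : Type*} [AddCommGroup X] [Module ℝ X]
    [FiniteDimensional ℝ X] (B : X →ₗ[ℝ] X →ₗ[ℝ] ℝ) (h : ∀ x, (∀ y, B x y = 0) → x = 0)
    (ℓ : X →ₗ[ℝ] ℝ) : ∃! x, ∀ y, B x y = ℓ y := by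
  have hinj : Function.Injective B := by
    rw [← LinearMap.ker_eq_bot, LinearMap.ker_eq_bot']
    exact fun x hx => h x fun y => by rw [hx]; rfl
  have hsurj : Function.Surjective B :=
    (LinearMap.injective_iff_surjective_of_finrank_eq_finrank
      (Subspace.dual_finrank_eq (K := ℝ) (V := X)).symm).1 hinj
  obtain ⟨x, hx⟩ := hsurj ℓ
  exact ⟨x, fun y => by rw [hx], fun x' hx' => hinj (by rw [hx]; exact LinearMap.ext hx')⟩

section Step

variable {Ω : Set E3} {F : Type*} [NormedAddCommGroup F] [InnerProductSpace ℝ F]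

/-- The left-hand side, tested with `v`, of the momentum equation without its pressure terms, and
of the temperature equation, for values in a general space `F`: `b` is the convecting velocity and
`ν` the viscosity or conductivity. -/
noncomputable def stepResidual (Ω : Set E3) (ν τ : ℝ) (σ₀ σ : E3 → ℝ) (b : E3 → E3)
    (u₀ u v : E3 → F) : ℝ :=
  ip Ω (fun x => σ x • τ⁻¹ • (σ x • u x - σ₀ x • u₀ x)) v
    + ν * ip Ω (partials u) (partials v)
    + ip Ω (fun x => (σ x) ^ 2 • fderiv ℝ u x (b x)) v
    + 1 / 2 * ip Ω (fun x => divg (fun y => (σ y) ^ 2 • b y) x • u x) v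

theorem temperature_eq_stepResidual (κ τ : ℝ) (σ₀ σ : E3 → ℝ) (b : E3 → E3)
    (θ₀ θ w : E3 → ℝ) :
    ip Ω (fun x => σ x * ((σ x * θ x - σ₀ x * θ₀ x) / τ)) w
      + κ * ip Ω (gradient θ) (gradient w)
      + ip Ω (fun x => (σ x) ^ 2 * fderiv ℝ θ x (b x)) w
      + 1 / 2 * ip Ω (fun x => θ x * divg (fun y => (σ y) ^ 2 • b y) x) w
    = stepResidual Ω κ τ σ₀ σ b θ₀ θ w := by
  rw [stepResidual, ip_gradient_gradient]
  simp only [smul_eq_mul, div_eq_inv_mul, mul_comm (θ _)]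

theorem inertia_isL2Op (hΩ : IsConvexPolyhedralDomain Ω) (τ : ℝ) {σ σ' : E3 → ℝ}
    (hσ : LipBdd Ω σ) (hσ' : LipBdd Ω σ') :
    IsL2Op Ω (fun (u : E3 → F) x => σ x • τ⁻¹ • σ' x • u x) :=
  (((IsL2Op.id hΩ).smul_left (hσ'.memLp_top hΩ)).smul_left
    ((LipBdd.const τ⁻¹).memLp_top hΩ)).smul_left (hσ.memLp_top hΩ)

theorem stabilization_isL2Op (hΩ : IsConvexPolyhedralDomain Ω) {σ : E3 → ℝ} {b : E3 → E3}
    (hσ : LipBdd Ω σ) (hb : LipBdd Ω b) :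
    IsL2Op Ω (fun (u : E3 → F) x => divg (fun y => (σ y) ^ 2 • b y) x • u x) :=
  (IsL2Op.id hΩ).smul_left ((hσ.sq.smul hb).divg_memLp_top hΩ)

variable [FiniteDimensional ℝ F]

/-- Convection together with its stabilization, in the form in which it occurs in the scheme, is
skew-symmetric. -/
theorem weighted_convection_self_eq_zero (hΩ : IsConvexPolyhedralDomain Ω) {σ : E3 → ℝ}
    {b : E3 → E3} {u : E3 → F} (hσ : LipBdd Ω σ) (hb : LipBdd Ω b) (hb0 : ∀ x ∉ Ω, b x = 0)
    (hu : LipBdd Ω u) :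
    ip Ω (fun x => (σ x) ^ 2 • fderiv ℝ u x (b x)) u
      + 1 / 2 * ip Ω (fun x => divg (fun y => (σ y) ^ 2 • b y) x • u x) u = 0 := by
  simpa only [map_smul] using
    convection_self_eq_zero hΩ (hσ.sq.smul hb) (fun x hx => by simp [hb0 x hx]) hu

theorem convection_isL2Op (hΩ : IsConvexPolyhedralDomain Ω) {σ : E3 → ℝ} {b : E3 → E3}
    (hσ : LipBdd Ω σ) (hb : LipBdd Ω b) :
    IsL2Op Ω (fun (u : E3 → F) x => (σ x) ^ 2 • fderiv ℝ u x (b x)) :=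
  (IsL2Op.fderiv_apply hΩ ((IsL2Op.id hΩ).memLp b hb)).smul_left (hσ.sq.memLp_top hΩ)

/-- The part of `stepResidual` that is linear in the unknown, as a bilinear form. -/
noncomputable def stepForm (hΩ : IsConvexPolyhedralDomain Ω) (ν τ : ℝ) {σ : E3 → ℝ} {b : E3 → E3}
    (hσ : LipBdd Ω σ) (hb : LipBdd Ω b) {X : Submodule ℝ (E3 → F)} (hX : ∀ u ∈ X, LipBdd Ω u) :
    X →ₗ[ℝ] X →ₗ[ℝ] ℝ :=
  (inertia_isL2Op hΩ τ hσ hσ).form (IsL2Op.id hΩ) hX hX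
    + ν • (IsL2Op.partials hΩ).form (IsL2Op.partials hΩ) hX hX
    + (convection_isL2Op hΩ hσ hb).form (IsL2Op.id hΩ) hX hX
    + (1 / 2 : ℝ) • (stabilization_isL2Op hΩ hσ hb).form (IsL2Op.id hΩ) hX hX

theorem stepForm_apply (hΩ : IsConvexPolyhedralDomain Ω) (ν τ : ℝ) {σ : E3 → ℝ} {b : E3 → E3}
    (hσ : LipBdd Ω σ) (hb : LipBdd Ω b) {X : Submodule ℝ (E3 → F)} (hX : ∀ u ∈ X, LipBdd Ω u)
    (u v : X) : stepForm hΩ ν τ hσ hb hX u v =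
      ip Ω (fun x => σ x • τ⁻¹ • σ x • u.1 x) v.1
        + ν * ip Ω (partials u.1) (partials v.1)
        + ip Ω (fun x => (σ x) ^ 2 • fderiv ℝ u.1 x (b x)) v.1
        + 1 / 2 * ip Ω (fun x => divg (fun y => (σ y) ^ 2 • b y) x • u.1 x) v.1 := rfl

theorem stepResidual_eq (hΩ : IsConvexPolyhedralDomain Ω) (ν τ : ℝ) {σ₀ σ : E3 → ℝ} {b : E3 → E3}
    (hσ₀ : LipBdd Ω σ₀) (hσ : LipBdd Ω σ) (hb : LipBdd Ω b) {X : Submodule ℝ (E3 → F)}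
    (hX : ∀ u ∈ X, LipBdd Ω u) {u₀ : E3 → F} (hu₀ : LipBdd Ω u₀) (u v : X) :
    stepResidual Ω ν τ σ₀ σ b u₀ u.1 v.1 =
      stepForm hΩ ν τ hσ hb hX u v - ip Ω (fun x => σ x • τ⁻¹ • σ₀ x • u₀ x) v.1 := by
  have h := ip_sub_left ((inertia_isL2Op hΩ τ hσ hσ).memLp _ (hX _ u.2))
    ((inertia_isL2Op hΩ τ hσ hσ₀).memLp _ hu₀) ((IsL2Op.id hΩ).memLp _ (hX _ v.2))
  have e : (fun x => σ x • τ⁻¹ • (σ x • u.1 x - σ₀ x • u₀ x)) =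
      (fun x => σ x • τ⁻¹ • σ x • u.1 x) - fun x => σ x • τ⁻¹ • σ₀ x • u₀ x := by
    funext x
    simp only [Pi.sub_apply, smul_sub]
  rw [stepResidual, e, h, stepForm_apply]
  ring

theorem stepForm_self (hΩ : IsConvexPolyhedralDomain Ω) (ν τ : ℝ) {σ : E3 → ℝ} {b : E3 → E3}
    (hσ : LipBdd Ω σ) (hb : LipBdd Ω b) (hb0 : ∀ x ∉ Ω, b x = 0) {X : Submodule ℝ (E3 → F)}
    (hX : ∀ u ∈ X, LipBdd Ω u) (u : X) :
    stepForm hΩ ν τ hσ hb hX u u =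
      τ⁻¹ * normSq Ω (fun x => σ x • u.1 x) + ν * normSq Ω (partials u.1) := by
  have h1 : ip Ω (fun x => σ x • τ⁻¹ • σ x • u.1 x) u.1 =
      τ⁻¹ * normSq Ω (fun x => σ x • u.1 x) := by
    rw [← ip_self, ← ip_smul_left]
    simp only [ip, Pi.smul_apply, real_inner_smul_left, real_inner_smul_right]
  rw [stepForm_apply, h1, ip_self]
  linarith [weighted_convection_self_eq_zero hΩ hσ hb hb0 (hX _ u.2)]

theorem eq_zero_of_stepForm_self (hΩ : IsConvexPolyhedralDomain Ω) {ν τ : ℝ} (hν : 0 < ν)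
    (hτ : 0 < τ) {σ : E3 → ℝ} {b : E3 → E3} (hσ : LipBdd Ω σ) (hb : LipBdd Ω b)
    (hb0 : ∀ x ∉ Ω, b x = 0) {X : Submodule ℝ (E3 → F)} (hX : ∀ u ∈ X, LipBdd Ω u)
    (hX0 : ∀ u ∈ X, ∀ x ∉ Ω, u x = 0) (u : X)
    (h : stepForm hΩ ν τ hσ hb hX u u = 0) : u = 0 := by
  rw [stepForm_self hΩ ν τ hσ hb hb0 hX] at h
  have h1 : 0 ≤ τ⁻¹ * normSq Ω (fun x => σ x • u.1 x) :=
    mul_nonneg (by positivity) (normSq_nonneg _)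
  have h2 : 0 ≤ normSq Ω (partials u.1) := normSq_nonneg _
  have h3 : normSq Ω (partials u.1) = 0 := by
    have : ν * normSq Ω (partials u.1) = 0 := by nlinarith
    exact (mul_eq_zero.1 this).resolve_left hν.ne'
  obtain ⟨R, hR, hR'⟩ := hΩ.exists_radius
  have h4 := poincare hΩ hR hR' (hX _ u.2) (hX0 _ u.2)
  rw [h3, mul_zero] at h4
  have h5 := (hX _ u.2).eq_zero_of_normSq hΩ (le_antisymm h4 (normSq_nonneg _))
  ext x
  by_cases hx : x ∈ closure Ω
  · rw [h5 x hx]; rfl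
  · rw [hX0 _ u.2 x fun h => hx (subset_closure h)]; rfl

/-- The energy estimate of one step. The forcing is absorbed by the diffusion through Young's
inequality and the Poincaré inequality, which fixes the constant. -/
theorem energy_estimate (hΩ : IsConvexPolyhedralDomain Ω) {R : ℝ} (hR : 0 < R)
    (hR' : ∀ x ∈ closure Ω, ‖x‖ ≤ R) {ν τ : ℝ} (hν : 0 < ν) (hτ : 0 < τ) {σ₀ σ : E3 → ℝ}
    {b : E3 → E3} (hσ₀ : LipBdd Ω σ₀) (hσ : LipBdd Ω σ) (hb : LipBdd Ω b)
    (hb0 : ∀ x ∉ Ω, b x = 0) {u₀ u f : E3 → F} (hu₀ : LipBdd Ω u₀) (hu : LipBdd Ω u)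
    (hu0 : ∀ x ∉ Ω, u x = 0) (hf : MemLp f 2 (volume.restrict Ω))
    (h : stepResidual Ω ν τ σ₀ σ b u₀ u u = ip Ω f u) :
    normSq Ω (fun x => σ x • u x) + ν * τ * normSq Ω (partials u) ≤
      normSq Ω (fun x => σ₀ x • u₀ x) + 4 * R ^ 2 / ν * (τ * normSq Ω f) := by
  have hid : IsL2Op Ω (fun u : E3 → F => u) := IsL2Op.id hΩ
  have h1 : ip Ω (fun x => σ x • τ⁻¹ • (σ x • u x - σ₀ x • u₀ x)) u =
      τ⁻¹ * ip Ω ((fun x => σ x • u x) - fun x => σ₀ x • u₀ x) (fun x => σ x • u x) := by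
    rw [← ip_smul_left]
    simp only [ip, Pi.smul_apply, Pi.sub_apply, real_inner_smul_left, real_inner_smul_right]
  have h2 := normSq_sub_normSq_le (hid.memLp _ (hσ.smul hu)) (hid.memLp _ (hσ₀.smul hu₀))
  have h3 := weighted_convection_self_eq_zero hΩ hσ hb hb0 hu
  have h4 := ip_le_young hf (hid.memLp _ hu) (ε := 4 * R ^ 2 / ν) (by positivity)
  have h5 := poincare hΩ hR hR' hu hu0
  rw [stepResidual, h1, ip_self] at h
  set A := normSq Ω (fun x => σ x • u x)
  set A₀ := normSq Ω (fun x => σ₀ x • u₀ x)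
  set P := normSq Ω (partials u)
  set I := ip Ω ((fun x => σ x • u x) - fun x => σ₀ x • u₀ x) (fun x => σ x • u x)
  have h6 : 1 / (2 * (4 * R ^ 2 / ν)) * normSq Ω u ≤ ν / 2 * P :=
    calc 1 / (2 * (4 * R ^ 2 / ν)) * normSq Ω u
        ≤ 1 / (2 * (4 * R ^ 2 / ν)) * (4 * R ^ 2 * P) := by gcongr
      _ = ν / 2 * P := by field_simp
  have h7 : τ⁻¹ * I + ν / 2 * P ≤ 4 * R ^ 2 / ν / 2 * normSq Ω f := by linarith
  have h8 := mul_le_mul_of_nonneg_left h7 (by positivity : 0 ≤ 2 * τ)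
  have h9 : 2 * τ * (τ⁻¹ * I + ν / 2 * P) = 2 * I + ν * τ * P := by
    field_simp
  rw [h9] at h8
  linarith

end Step

/-! ### The density equation -/

section Density

variable {Ω : Set E3}

/-- Transport by a field of zero divergence and zero normal trace conserves the `L²` norm. -/
theorem transport_self_eq_zero (hΩ : IsConvexPolyhedralDomain Ω) {w : L2 E3 Ω}
    (hw : HasZeroNormalTrace Ω w 0) {σ : E3 → ℝ} (hσ : LipBdd Ω σ) :
    ip Ω (fun x => fderiv ℝ σ x (w x)) σ = 0 := by
  have h := hw.integral_fderiv_eq_zero hΩ (hσ.inner hσ)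
  rw [← mul_zero (1 / 2 : ℝ), ← h, ← integral_const_mul]
  refine integral_congr_ae ?_
  filter_upwards [hσ.ae_differentiableAt hΩ] with x hx
  rw [fderiv_norm_sq_apply hx]
  ring

/-- The left-hand side of the density equation, up to the term with the old density, as a bilinear
form. -/
noncomputable def densityForm (hΩ : IsConvexPolyhedralDomain Ω) (τ : ℝ) (w : L2 E3 Ω)
    {X : Submodule ℝ (E3 → ℝ)} (hX : ∀ u ∈ X, LipBdd Ω u) : X →ₗ[ℝ] X →ₗ[ℝ] ℝ :=
  τ⁻¹ • (IsL2Op.id hΩ).form (IsL2Op.id hΩ) hX hX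
    + (IsL2Op.fderiv_apply hΩ (Lp.memLp w)).form (IsL2Op.id hΩ) hX hX

theorem density_eq (hΩ : IsConvexPolyhedralDomain Ω) (τ : ℝ) (w : L2 E3 Ω)
    {X : Submodule ℝ (E3 → ℝ)} (hX : ∀ u ∈ X, LipBdd Ω u) (σ₀ σ r : X) :
    ip Ω (fun x => (σ.1 x - σ₀.1 x) / τ) r.1
      + ip Ω (fun x => inner ℝ (gradient σ.1 x) (w x)) r.1 =
    densityForm hΩ τ w hX σ r - τ⁻¹ * ip Ω σ₀.1 r.1 := by
  have hid : IsL2Op Ω (fun u : E3 → ℝ => u) := IsL2Op.id hΩ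
  have e : (fun x => (σ.1 x - σ₀.1 x) / τ) = τ⁻¹ • (σ.1 - σ₀.1) := by
    funext x
    simp [div_eq_inv_mul]
  rw [e, ip_smul_left, ip_sub_left (hid.memLp _ (hX _ σ.2)) (hid.memLp _ (hX _ σ₀.2))
    (hid.memLp _ (hX _ r.2))]
  simp only [inner_gradient_left]
  change _ = τ⁻¹ * ip Ω σ.1 r.1 + ip Ω (fun x => fderiv ℝ σ.1 x (w x)) r.1 - _
  ring

theorem densityForm_self (hΩ : IsConvexPolyhedralDomain Ω) (τ : ℝ) {w : L2 E3 Ω}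
    (hw : HasZeroNormalTrace Ω w 0) {X : Submodule ℝ (E3 → ℝ)} (hX : ∀ u ∈ X, LipBdd Ω u)
    (σ : X) : densityForm hΩ τ w hX σ σ = τ⁻¹ * normSq Ω σ.1 := by
  change τ⁻¹ * ip Ω σ.1 σ.1 + ip Ω (fun x => fderiv ℝ σ.1 x (w x)) σ.1 = _
  rw [transport_self_eq_zero hΩ hw (hX _ σ.2), ip_self, add_zero]

end Density

/-! ### Unique solvability and stability of the scheme -/

namespace TetMesh

variable {Ω : Set E3} (T : TetMesh Ω)

theorem P0_hasZeroNormalTrace (u : T.V) : HasZeroNormalTrace Ω (T.P0 u) 0 :=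
  (T.RT0.starProjection_apply_mem _ : T.P0 u ∈ T.RT0).2.2

theorem density_existsUnique (hΩ : IsConvexPolyhedralDomain Ω) {τ : ℝ} (hτ : 0 < τ) (σ₀ : T.W)
    (u₀ : T.V) : ∃! σ : T.W, ∀ r : T.W, ip Ω (fun x => (σ.1 x - σ₀.1 x) / τ) r.1
      + ip Ω (fun x => inner ℝ (gradient σ.1 x) (T.P0 u₀ x)) r.1 = 0 := by
  have hX := T.lipBdd_W hΩ
  simp only [density_eq hΩ τ (T.P0 u₀) hX σ₀, sub_eq_zero]
  refine existsUnique_of_ker_eq_zero _ (fun σ hσ => ?_)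
    (τ⁻¹ • load hΩ hX ((IsL2Op.id hΩ).memLp _ (hX _ σ₀.2)))
  have h := hσ σ
  rw [densityForm_self hΩ τ (T.P0_hasZeroNormalTrace u₀)] at h
  have h0 := (hX _ σ.2).eq_zero_of_normSq hΩ
    ((mul_eq_zero.1 h).resolve_left (inv_pos.2 hτ).ne')
  ext x
  by_cases hx : x ∈ closure Ω
  · exact h0 x hx
  · exact σ.2.2.1 x hx

theorem momentum_existsUnique (hΩ : IsConvexPolyhedralDomain Ω) {μ τ : ℝ} (hμ : 0 < μ)
    (hτ : 0 < τ) {f : E3 → E3} (hf : MemLp f 2 (volume.restrict Ω)) (σ₀ σ : T.W) (u₀ : T.V) :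
    ∃! z : T.V × T.M, ∀ (v : T.V) (q : T.M), stepResidual Ω μ τ σ₀.1 σ.1 u₀.1 u₀.1 z.1.1 v.1
      - ip Ω (divg v.1) z.2.1 + ip Ω (divg z.1.1) q.1 = ip Ω f v.1 := by
  have hV := T.lipBdd_V hΩ
  have hM := T.lipBdd_M hΩ
  have hσ₀ := T.lipBdd_W hΩ _ σ₀.2
  have hσ := T.lipBdd_W hΩ _ σ.2
  have hu₀ := hV _ u₀.2
  let S : T.V →ₗ[ℝ] T.V →ₗ[ℝ] ℝ := stepForm hΩ μ τ hσ hu₀ hV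
  let D : T.V →ₗ[ℝ] T.M →ₗ[ℝ] ℝ := (IsL2Op.divg hΩ).form (IsL2Op.id hΩ) hV hM
  let fst := LinearMap.fst ℝ T.V T.M
  let snd := LinearMap.snd ℝ T.V T.M
  let B : T.V × T.M →ₗ[ℝ] T.V × T.M →ₗ[ℝ] ℝ :=
    S.compl₁₂ fst fst - D.flip.compl₁₂ snd fst + D.compl₁₂ fst snd
  let ℓ : T.V →ₗ[ℝ] ℝ :=
    load hΩ hV hf + load hΩ hV ((inertia_isL2Op hΩ τ hσ hσ₀).memLp _ hu₀)
  have hB : ∀ z y : T.V × T.M, B z y = S z.1 y.1 - D y.1 z.2 + D z.1 y.2 := fun _ _ => rfl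
  have hker : ∀ z, (∀ y, B z y = 0) → z = 0 := by
    rintro ⟨u, p⟩ h
    have hu : u = 0 := by
      -- Testing with the solution itself makes the two pressure terms cancel.
      have h0 := h (u, p)
      simp only [hB, sub_add_cancel] at h0
      exact eq_zero_of_stepForm_self hΩ hμ hτ hσ hu₀ (T.V_eq_zero hΩ u₀.2) hV
        (fun _ hv => T.V_eq_zero hΩ hv) u h0
    subst hu
    have hp : p = 0 := T.pressure_eq_zero hΩ p fun v => by
      have h0 := h (v, 0)
      simp only [hB, map_zero, LinearMap.zero_apply, zero_sub, add_zero, neg_eq_zero] at h0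
      exact h0
    rw [hp]
    rfl
  have key : ∀ z : T.V × T.M, (∀ (v : T.V) (q : T.M),
      stepResidual Ω μ τ σ₀.1 σ.1 u₀.1 u₀.1 z.1.1 v.1
        - ip Ω (divg v.1) z.2.1 + ip Ω (divg z.1.1) q.1 = ip Ω f v.1) ↔
      ∀ y, B z y = (ℓ.comp fst) y := by
    intro z
    rw [Prod.forall]
    refine forall₂_congr fun v q => ?_
    rw [stepResidual_eq hΩ μ τ hσ₀ hσ hu₀ hV hu₀]
    change _ ↔ S z.1 v - ip Ω (divg v.1) z.2.1 + ip Ω (divg z.1.1) q.1 =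
      ip Ω f v.1 + ip Ω (fun x => σ.1 x • τ⁻¹ • σ₀.1 x • u₀.1 x) v.1
    constructor <;> intro h <;> linarith
  simp only [key]
  exact existsUnique_of_ker_eq_zero B hker _

theorem temperature_existsUnique (hΩ : IsConvexPolyhedralDomain Ω) {κ τ : ℝ} (hκ : 0 < κ)
    (hτ : 0 < τ) {g : E3 → ℝ} (hg : MemLp g 2 (volume.restrict Ω)) (σ₀ σ : T.W) (u₀ : T.V)
    (θ₀ : T.F) :
    ∃! θ : T.F, ∀ w : T.F, stepResidual Ω κ τ σ₀.1 σ.1 u₀.1 θ₀.1 θ.1 w.1 = ip Ω g w.1 := by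
  have hF := T.lipBdd_F hΩ
  have hσ₀ := T.lipBdd_W hΩ _ σ₀.2
  have hσ := T.lipBdd_W hΩ _ σ.2
  have hu₀ := T.lipBdd_V hΩ _ u₀.2
  simp only [stepResidual_eq hΩ κ τ hσ₀ hσ hu₀ hF (hF _ θ₀.2), sub_eq_iff_eq_add]
  exact existsUnique_of_ker_eq_zero _
    (fun θ h => eq_zero_of_stepForm_self hΩ hκ hτ hσ hu₀ (T.V_eq_zero hΩ u₀.2) hF
      (fun _ hw => T.F_eq_zero hΩ hw) θ (h θ))
    (load hΩ hF hg + load hΩ hF ((inertia_isL2Op hΩ τ hσ hσ₀).memLp _ (hF _ θ₀.2)))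

theorem step_existsUnique (hΩ : IsConvexPolyhedralDomain Ω) {μ κ τ : ℝ} (hμ : 0 < μ) (hκ : 0 < κ)
    (hτ : 0 < τ) {f : E3 → E3} {g : E3 → ℝ} (hf : MemLp f 2 (volume.restrict Ω))
    (hg : MemLp g 2 (volume.restrict Ω)) (σ₀ : T.W) (u₀ : T.V) (θ₀ : T.F) :
    ∃! z : T.W × T.V × T.M × T.F,
      T.IsStep μ κ τ f g σ₀ u₀ θ₀ z.1 z.2.1 z.2.2.1 z.2.2.2 := by
  obtain ⟨σ, hσ, hσ'⟩ := T.density_existsUnique hΩ hτ σ₀ u₀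
  obtain ⟨⟨u, p⟩, hu, hu'⟩ := T.momentum_existsUnique hΩ hμ hτ hf σ₀ σ u₀
  obtain ⟨θ, hθ, hθ'⟩ := T.temperature_existsUnique hΩ hκ hτ hg σ₀ σ u₀ θ₀
  refine ⟨(σ, u, p, θ), ⟨hσ, hu, fun w => ?_⟩, ?_⟩
  · rw [temperature_eq_stepResidual]
    exact hθ w
  · rintro ⟨σ₁, u₁, p₁, θ₁⟩ ⟨h1, h2, h3⟩
    simp only [temperature_eq_stepResidual] at h1 h2 h3
    have e1 : σ₁ = σ := hσ' _ h1
    subst e1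
    have e2 : (u₁, p₁) = (u, p) := hu' _ h2
    have e3 : θ₁ = θ := hθ' _ h3
    rw [Prod.mk.injEq] at e2
    rw [e2.1, e2.2, e3]

variable {T} in
theorem IsStep.density_estimate (hΩ : IsConvexPolyhedralDomain Ω) {μ κ τ : ℝ} (hτ : 0 < τ)
    {f : E3 → E3} {g : E3 → ℝ} {σ₀ σ : T.W} {u₀ u : T.V} {p : T.M} {θ₀ θ : T.F}
    (h : T.IsStep μ κ τ f g σ₀ u₀ θ₀ σ u p θ) : normSq Ω σ.1 ≤ normSq Ω σ₀.1 := by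
  have hX := T.lipBdd_W hΩ
  have hid : IsL2Op Ω (fun u : E3 → ℝ => u) := IsL2Op.id hΩ
  have h1 := h.density σ
  rw [density_eq hΩ τ (T.P0 u₀) hX σ₀, densityForm_self hΩ τ (T.P0_hasZeroNormalTrace u₀),
    ← mul_sub] at h1
  have h2 := (mul_eq_zero.1 h1).resolve_left (inv_pos.2 hτ).ne'
  have h3 := ip_le_young (hid.memLp _ (hX _ σ₀.2)) (hid.memLp _ (hX _ σ.2)) one_pos
  linarith

end TetMesh

/-- Telescoping of one-step estimates. -/
theorem sum_le_of_step_le {N : ℕ} {a b c : ℕ → ℝ} {s t : ℝ}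
    (h : ∀ n < N, a (n + 1) + s * b (n + 1) ≤ a n + t * c (n + 1)) :
    ∀ n < N, a (n + 1) + s * ∑ k ∈ Finset.range (n + 1), b (k + 1) ≤
      a 0 + t * ∑ k ∈ Finset.range (n + 1), c (k + 1) := by
  intro n
  induction n with
  | zero => intro hn; simpa using h 0 hn
  | succ n ih =>
    intro hn
    have h1 := ih (by omega)
    have h2 := h (n + 1) hn
    rw [Finset.sum_range_succ, Finset.sum_range_succ _ (n + 1), mul_add, mul_add]
    linarith

end FEM

theorem lemma3p1 (Ω : Set FEM.E3) (hΩ : FEM.IsConvexPolyhedralDomain Ω) :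
    ∃ C : ℝ, 0 < C ∧ ∀ (T : FEM.TetMesh Ω) (μ κ τ : ℝ), 0 < μ → 0 < κ → 0 < τ →
      (∀ (f : FEM.E3 → FEM.E3) (g : FEM.E3 → ℝ),
        MemLp f 2 (volume.restrict Ω) → MemLp g 2 (volume.restrict Ω) →
        ∀ (σ₀ : T.W) (u₀ : T.V) (θ₀ : T.F),
          ∃! z : T.W × T.V × T.M × T.F,
            T.IsStep μ κ τ f g σ₀ u₀ θ₀ z.1 z.2.1 z.2.2.1 z.2.2.2) ∧
      (∀ (N : ℕ) (f : ℕ → FEM.E3 → FEM.E3) (g : ℕ → FEM.E3 → ℝ),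
        (∀ n < N, MemLp (f (n + 1)) 2 (volume.restrict Ω)) →
        (∀ n < N, MemLp (g (n + 1)) 2 (volume.restrict Ω)) →
        ∀ (σ : ℕ → T.W) (u : ℕ → T.V) (p : ℕ → T.M) (θ : ℕ → T.F),
          (∀ n < N, T.IsStep μ κ τ (f (n + 1)) (g (n + 1)) (σ n) (u n) (θ n)
            (σ (n + 1)) (u (n + 1)) (p (n + 1)) (θ (n + 1))) →
          ∀ n < N,
            FEM.normSq Ω (σ (n + 1)).1 ≤ FEM.normSq Ω (σ 0).1 ∧
            FEM.normSq Ω (fun x => (σ (n + 1)).1 x * (θ (n + 1)).1 x)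
                + κ * τ * ∑ k ∈ Finset.range (n + 1), FEM.normSq Ω (gradient (θ (k + 1)).1)
              ≤ FEM.normSq Ω (fun x => (σ 0).1 x * (θ 0).1 x)
                + C / κ * (τ * ∑ k ∈ Finset.range (n + 1), FEM.normSq Ω (g (k + 1))) ∧
            FEM.normSq Ω (fun x => (σ (n + 1)).1 x • (u (n + 1)).1 x)
                + μ * τ * ∑ k ∈ Finset.range (n + 1), FEM.normSq Ω (FEM.vgrad (u (k + 1)).1)
              ≤ FEM.normSq Ω (fun x => (σ 0).1 x • (u 0).1 x)
                + C / μ * (τ * ∑ k ∈ Finset.range (n + 1), FEM.normSq Ω (f (k + 1))) ∧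
            FEM.normSq Ω (fun x => (σ (n + 1)).1 x • (u (n + 1)).1 x)
                + 2 * μ * τ * ∑ k ∈ Finset.range (n + 1), FEM.normSq Ω (FEM.vgrad (u (k + 1)).1)
              ≤ 2 * FEM.normSq Ω (fun x => (σ 0).1 x • (u 0).1 x)
                + 2 * C / μ * (τ * ∑ k ∈ Finset.range (n + 1), FEM.normSq Ω (f (k + 1)))) := by
  obtain ⟨R, hR, hR'⟩ := hΩ.exists_radius
  refine ⟨4 * R ^ 2, by positivity, fun T μ κ τ hμ hκ hτ => ⟨fun f g hf hg σ₀ u₀ θ₀ =>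
    T.step_existsUnique hΩ hμ hκ hτ hf hg σ₀ u₀ θ₀, ?_⟩⟩
  intro N f g hf hg σ u p θ hstep
  have hσ := fun n => T.lipBdd_W hΩ _ (σ n).2
  have hu := fun n => T.lipBdd_V hΩ _ (u n).2
  have hθ := fun n => T.lipBdd_F hΩ _ (θ n).2
  have hu0 := fun n => T.V_eq_zero hΩ (u n).2
  have hθ0 := fun n => T.F_eq_zero hΩ (θ n).2
  have hdens : ∀ n < N, FEM.normSq Ω (σ (n + 1)).1 ≤ FEM.normSq Ω (σ 0).1 := by
    intro n hn
    have h := FEM.sum_le_of_step_le (a := fun n => FEM.normSq Ω (σ n).1) (b := 0) (c := 0) (s := 0)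
      (t := 0) (fun n hn => by simpa using (hstep n hn).density_estimate hΩ hτ) n hn
    simpa using h
  have htemp := FEM.sum_le_of_step_le (N := N) (s := κ * τ) (t := 4 * R ^ 2 / κ * τ)
    (a := fun n => FEM.normSq Ω (fun x => (σ n).1 x * (θ n).1 x))
    (b := fun n => FEM.normSq Ω (gradient (θ n).1)) (c := fun n => FEM.normSq Ω (g n))
    fun n hn => by
      have h := (hstep n hn).temperature (θ (n + 1))
      rw [FEM.temperature_eq_stepResidual] at h
      have h' := FEM.energy_estimate hΩ hR hR' hκ hτ (hσ n) (hσ (n + 1)) (hu n) (hu0 n) (hθ n)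
        (hθ (n + 1)) (hθ0 (n + 1)) (hg n hn) h
      rw [FEM.normSq_gradient, mul_assoc (4 * R ^ 2 / κ)]
      exact h'
  have hmom := FEM.sum_le_of_step_le (N := N) (s := μ * τ) (t := 4 * R ^ 2 / μ * τ)
    (a := fun n => FEM.normSq Ω (fun x => (σ n).1 x • (u n).1 x))
    (b := fun n => FEM.normSq Ω (FEM.vgrad (u n).1)) (c := fun n => FEM.normSq Ω (f n))
    fun n hn => by
      have h : FEM.stepResidual Ω μ τ (σ n).1 (σ (n + 1)).1 (u n).1 (u n).1 (u (n + 1)).1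
          (u (n + 1)).1 = FEM.ip Ω (f (n + 1)) (u (n + 1)).1 := by
        -- With `q = p` the two pressure terms cancel.
        have h := (hstep n hn).momentum (u (n + 1)) (p (n + 1))
        rw [sub_add_cancel] at h
        exact h
      have h' := FEM.energy_estimate hΩ hR hR' hμ hτ (hσ n) (hσ (n + 1)) (hu n) (hu0 n) (hu n)
        (hu (n + 1)) (hu0 (n + 1)) (hf n hn) h
      rw [FEM.vgrad_eq_partials, mul_assoc (4 * R ^ 2 / μ)]
      exact h'
  intro n hn
  have h1 := htemp n hn
  have h2 := hmom n hn
  have h3 : 0 ≤ FEM.normSq Ω (fun x => (σ (n + 1)).1 x • (u (n + 1)).1 x) := FEM.normSq_nonneg _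
  simp only [mul_assoc (4 * R ^ 2 / κ), mul_assoc (4 * R ^ 2 / μ)] at h1 h2
  refine ⟨hdens n hn, h1, h2, ?_⟩
  rw [mul_div_assoc 2 (4 * R ^ 2) μ]
  linarith
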